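/- Let $d\ge 1$, let $g(t,x,y)=(4\pi t)^{-d/2}e^{-|y-x|^2/(4t)}$ for $t>0$, $x,y\in\mathbb R^d$, and let $V:\mathbb R^d\to[-\infty,0]$ be Borel measurable. Put $$S(V,t,x,y)=\int_0^t\int_{\mathbb R^d}\frac{g(s,x,z)\,g(t-s,z,y)}{g(t,x,y)}\,|V(z)|\,dz\,ds\in[0,\infty].$$ Let $G$ be the Schrödinger perturbation of $g$ by $V$, i.e. $G=\inf_{n} G_n$ (a decreasing limit), where $G_n$ is the sum of the absolutely convergent perturbation series of $g$ by the bounded function $V_n=\max(V,-n)$: $G_n=\sum_{k\ge0}p_k^{(n)}$, $p_0^{(n)}=g$, $p_{k+1}^{(n)}(t,x,y)=\int_0^t\int_{\mathbb R^d}p_k^{(n)}(s,x,z)V_n(z)g(t-s,z,y)\,dz\,ds$. Let $T>0$. Then the local sharp Gaussian bounds $$\text{there are } 0<c_1\le c_2<\infty \text{ with } c_1\le \frac{G(t,x,y)}{g(t,x,y)}\le c_2\quad\text{for all } 0<t\le T,\ x,y\in\mathbb R^d \tag{1}$$ hold if and only if there are constants $C>0$ and $c\ge 0$ such that $$C e^{-ct}g(t,x,y)\le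 G(t,x,y)\quad\text{for all } t>0,\ x,y\in\mathbb R^d. \tag{2}$$ Moreover, if (1) holds, then $\sup_{0<t\le T,\,x,y}S(V,t,x,y)<\infty$, and (2) holds with $$\ln C=-\sup_{0<t\le T,\ x,y\in\mathbb R^d}S(V,t,x,y),\qquad c=\frac1T\sup_{x,y\in\mathbb R^d}S(V,T,x,y).$$ The kernel $G$ is determined by the Duhamel formula $$H(t,x,y)=g(t,x,y)+\int_0^t\int_{\mathbb R^d}H(s,x,z)V(z)g(t-s,z,y)\,dz\,ds,\qquad t>0,\ x,y\in\mathbb R^d, \tag{3}$$ in the following sense: every nonnegative Borel function $H$ on $(0,\infty)\times\mathbb R^d\times\mathbb R^d$ satisfying (3) with an absolutely convergent integral (convention $0\cdot\infty=0$) is equal to $G$, and if (1) holds, then $H=G$ satisfies (3). -/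

import Mathlib

open MeasureTheory Set
open scoped ENNReal

noncomputable section

namespace Schroedinger

/-- The space `ℝ^d` with its Euclidean norm. -/
abbrev Space (d : ℕ) : Type := EuclideanSpace ℝ (Fin d)

variable {d : ℕ}

/-- The Gauss-Weierstrass kernel `g(t,x,y) = (4πt)^{-d/2} exp(-|y-x|²/(4t))` (used for `t > 0`). -/
def gauss (t : ℝ) (x y : Space d) : ℝ :=
  (4 * Real.pi * t) ^ (-(d : ℝ) / 2) * Real.exp (-‖y - x‖ ^ 2 / (4 * t))

/-- The bridge potential
`S(V,t,x,y) = ∫₀ᵗ ∫ g(s,x,z) g(t-s,z,y) / g(t,x,y) |V(z)| dz ds`, with values in `[0,∞]`. -/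
def bridgePotential (V : Space d → EReal) (t : ℝ) (x y : Space d) : ℝ≥0∞ :=
  ∫⁻ s in Ioo 0 t, ∫⁻ z : Space d,
    ENNReal.ofReal (gauss s x z * gauss (t - s) z y / gauss t x y) * (V z).abs

/-- The terms of the perturbation series of `g` by a nonnegative function `q`:
`p₀ = g` and `pₖ₊₁(t,x,y) = ∫₀ᵗ ∫ pₖ(s,x,z) q(z) g(t-s,z,y) dz ds`. -/
def seriesTerm (q : Space d → ℝ≥0∞) : ℕ → ℝ → Space d → Space d → ℝ≥0∞
  | 0, t, x, y => ENNReal.ofReal (gauss t x y)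
  | k + 1, t, x, y => ∫⁻ s in Ioo 0 t, ∫⁻ z : Space d,
      seriesTerm q k s x z * q z * ENNReal.ofReal (gauss (t - s) z y)

/-- The perturbation series of `g` by the bounded potential `Vₙ = max(V, -n)`, where `V ≤ 0`.
Here `|Vₙ| = min(|V|, n)`, and since `Vₙ ≤ 0` the `k`-th term of the series is `(-1)ᵏ` times the
`k`-th term for `|Vₙ|`.  As `Vₙ` is bounded, the series converges absolutely for `t > 0`. -/
def truncatedKernel (V : Space d → EReal) (n : ℕ) (t : ℝ) (x y : Space d) : ℝ :=
  ∑' k : ℕ, (-1 : ℝ) ^ k * (seriesTerm (fun z => min (V z).abs (n : ℝ≥0∞)) k t x y).toReal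

/-- The Schrödinger perturbation `G` of `g` by `V ≤ 0`: the decreasing limit (the infimum) over `n`
of the nonnegative kernels of the truncated potentials `max(V, -n)`.  In Feynman-Kac terms it is
`g(t,x,y)` times the expectation of `exp(∫₀ᵗ V)` over the bridge from `x` to `y` in time `t`. -/
def schroedingerKernel (V : Space d → EReal) (t : ℝ) (x y : Space d) : ℝ :=
  ⨅ n : ℕ, truncatedKernel V n t x y

/-- `H` is a nonnegative Borel solution on `(0,∞) × ℝ^d × ℝ^d` of the Duhamel formula
`H(t,x,y) = g(t,x,y) + ∫₀ᵗ ∫ H(s,x,z) V(z) g(t-s,z,y) dz ds`, where `V ≤ 0`.  The nonpositive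
integral is moved to the other side, so that both sides are sums in `[0,∞]`; as the right side is
finite, absolute convergence of the integral is part of the formula. -/
structure IsDuhamelSolution (V : Space d → EReal) (H : ℝ → Space d → Space d → ℝ) : Prop where
  measurable : Measurable fun p : Ioi (0 : ℝ) × Space d × Space d => H p.1 p.2.1 p.2.2
  nonneg : ∀ t : ℝ, 0 < t → ∀ x y, 0 ≤ H t x y
  duhamel : ∀ t : ℝ, 0 < t → ∀ x y,
    ENNReal.ofReal (H t x y) +
      (∫⁻ s in Ioo 0 t, ∫⁻ z : Space d,
        ENNReal.ofReal (H s x z) * (V z).abs * ENNReal.ofReal (gauss (t - s) z y)) =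
    ENNReal.ofReal (gauss t x y)

/-- Sharp Gaussian estimates for `G`, local in time: `c₁ ≤ G/g ≤ c₂` for `0 < t ≤ T`. -/
def LocalSharpBounds (G : ℝ → Space d → Space d → ℝ) (T : ℝ) : Prop :=
  ∃ c₁ c₂ : ℝ, 0 < c₁ ∧ c₁ ≤ c₂ ∧ ∀ t : ℝ, 0 < t → t ≤ T → ∀ x y : Space d,
    c₁ ≤ G t x y / gauss t x y ∧ G t x y / gauss t x y ≤ c₂

/-- The lower bound `C e^{-ct} g(t,x,y) ≤ G(t,x,y)` for all `t > 0` and all `x, y`. -/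
def ExpLowerBound (G : ℝ → Space d → Space d → ℝ) (C c : ℝ) : Prop :=
  ∀ t : ℝ, 0 < t → ∀ x y : Space d, C * Real.exp (-c * t) * gauss t x y ≤ G t x y

/-- `f(t) = sup_{x,y} S(V,t,x,y)`. -/
def supBridge (V : Space d → EReal) (t : ℝ) : ℝ≥0∞ :=
  ⨆ (x : Space d) (y : Space d), bridgePotential V t x y

/-- `sup_{0<t≤T, x, y} S(V,t,x,y)`. -/
def supBridgeUpTo (V : Space d → EReal) (T : ℝ) : ℝ≥0∞ :=
  ⨆ t ∈ Ioc 0 T, supBridge V t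

end Schroedinger

end

namespace Schroedinger

open Filter Topology
open scoped NNReal

variable {d : ℕ}

/-! Write `q = |V|`, and let `A q B` denote the space-time composition `conv A q B`. In these terms
`S = (g q g)/g` and Duhamel's formula is `G + G q g = g`. Everything is done in `[0,∞]`, with
subtraction replaced by cancellation of finite terms.

Bounded potentials. If `q ≤ M`, the kernel is built without signs: damp `g` by `e^{-Mt}`, then
perturb by the nonnegative function `M - q` (`killedHeat`). It satisfies Duhamel's formula on both
sides, and iterating the formula identifies it with the alternating series (`hasSum_seriesTerm`).
The resolvent identity between two potentials shows that it decreases when `q` is truncated at a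
higher level, and that every Duhamel solution for the full `q` lies below all truncated kernels.
Dominated convergence then proves uniqueness, and also existence when `g q g` is finite.

Lower bound. In Feynman-Kac terms `G/g` is the bridge expectation of `exp(-∫q)`, so Jensen's
inequality gives `G ≥ g e^{-S}`. No bridge process is used here. For small `t`, Duhamel's formula
gives `G ≥ g(1 - S)`, which loses only `O(t²)` in the exponent against `g e^{-S}`. The bridge
average of `S(s,x,z) + S(t,z,y)` over `z` is `S(s+t,x,y)`, so convexity of `exp` makes `g e^{-S}` at
time `s+t` at most the product of its values at times `s` and `t`, integrated over `z`. The product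
of killed kernels has the opposite inequality. Hence the small-time bound can be chained over `n`
steps, and the total loss is `O(1/n)`.

Equivalence. If `c₁ g ≤ G` up to time `T`, then `c₁ g q g ≤ G q g ≤ g`, so `S ≤ 1/c₁` there. The
supremum of `S` over `x, y` is subadditive in time, hence grows at most linearly, and `G ≥ g e^{-S}`
yields the exponential bound with the stated constants. The converse uses `G ≤ g`. -/

/-- A kernel in time and two space variables. -/
abbrev TimeKernel (d : ℕ) : Type := ℝ → Space d → Space d → ℝ≥0∞

/-- Joint Borel measurability of a time-dependent kernel. -/
def MeasKer (A : TimeKernel d) : Prop :=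
  Measurable fun p : ℝ × Space d × Space d => A p.1 p.2.1 p.2.2

/-- The space-time composition `∫₀ᵗ ∫ A(s,x,z) q(z) B(t-s,z,y) dz ds`. -/
noncomputable def conv (A : TimeKernel d) (q : Space d → ℝ≥0∞) (B : TimeKernel d) :
    TimeKernel d :=
  fun t x y => ∫⁻ s in Ioo 0 t, ∫⁻ z : Space d, A s x z * q z * B (t - s) z y

/-- The Gauss-Weierstrass kernel as a `TimeKernel`, extended by `0` to `t ≤ 0`. -/
noncomputable def heat (d : ℕ) : TimeKernel d :=
  fun t x y => if 0 < t then ENNReal.ofReal (gauss t x y) else 0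

/-- The Chapman-Kolmogorov equations. -/
def IsSemigroup (b : TimeKernel d) : Prop :=
  ∀ s t : ℝ, 0 < s → 0 < t → ∀ x y, ∫⁻ z : Space d, b s x z * b t z y = b (s + t) x y

/-! ### The Gaussian kernel and its Chapman-Kolmogorov equations -/

theorem gauss_pos {t : ℝ} (ht : 0 < t) (x y : Space d) : 0 < gauss t x y := by
  unfold gauss
  positivity

theorem heat_of_pos {t : ℝ} (ht : 0 < t) (x y : Space d) :
    heat d t x y = ENNReal.ofReal (gauss t x y) := if_pos ht

theorem heat_ne_zero {t : ℝ} (ht : 0 < t) (x y : Space d) : heat d t x y ≠ 0 := by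
  rw [heat_of_pos ht]
  exact (ENNReal.ofReal_pos.2 (gauss_pos ht x y)).ne'

theorem heat_ne_top (t : ℝ) (x y : Space d) : heat d t x y ≠ ⊤ := by
  unfold heat
  split_ifs <;> simp

theorem measurable_gauss :
    Measurable fun p : ℝ × Space d × Space d => gauss p.1 p.2.1 p.2.2 := by
  unfold gauss
  fun_prop

theorem measKer_heat : MeasKer (heat d) := by
  unfold MeasKer heat
  exact Measurable.ite (measurableSet_lt measurable_const measurable_fst)
    measurable_gauss.ennreal_ofReal measurable_const

/-- Completing the square in `z`: the bridge from `x` to `y` is Gaussian at time `s`, centred on the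
segment at the fraction `s / (s + t)`. -/
theorem bridge_exponent {s t : ℝ} (hs : 0 < s) (ht : 0 < t) (x y z : Space d) :
    -‖z - x‖ ^ 2 / (4 * s) + -‖y - z‖ ^ 2 / (4 * t) =
      -‖y - x‖ ^ 2 / (4 * (s + t)) +
        -((s + t) / (4 * s * t)) * ‖z - (x + (s / (s + t)) • (y - x))‖ ^ 2 := by
  have e1 : y - z = (y - x) - (z - x) := by abel
  have e2 : z - (x + (s / (s + t)) • (y - x)) = (z - x) - (s / (s + t)) • (y - x) := by abel
  rw [e1, e2]
  generalize y - x = b, z - x = a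
  rw [norm_sub_sq_real, norm_sub_sq_real, norm_smul, inner_smul_right,
    real_inner_comm, mul_pow, Real.norm_eq_abs, sq_abs]
  field_simp
  ring

theorem gauss_mul_gauss {s t : ℝ} (hs : 0 < s) (ht : 0 < t) (x y z : Space d) :
    gauss s x z * gauss t z y = gauss (s + t) x y *
      ((Real.pi / ((s + t) / (4 * s * t))) ^ (-(d : ℝ) / 2) *
        Real.exp (-((s + t) / (4 * s * t)) * ‖z - (x + (s / (s + t)) • (y - x))‖ ^ 2)) := by
  unfold gauss
  have h1 : (4 * Real.pi * s) ^ (-(d : ℝ) / 2) * (4 * Real.pi * t) ^ (-(d : ℝ) / 2) =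
      (4 * Real.pi * (s + t)) ^ (-(d : ℝ) / 2) *
        (Real.pi / ((s + t) / (4 * s * t))) ^ (-(d : ℝ) / 2) := by
    rw [← Real.mul_rpow (by positivity) (by positivity),
      ← Real.mul_rpow (by positivity) (by positivity)]
    congr 1
    field_simp
  calc _ = ((4 * Real.pi * s) ^ (-(d : ℝ) / 2) * (4 * Real.pi * t) ^ (-(d : ℝ) / 2)) *
        (Real.exp (-‖z - x‖ ^ 2 / (4 * s)) * Real.exp (-‖y - z‖ ^ 2 / (4 * t))) := by ring
    _ = _ := by
      rw [h1, ← Real.exp_add, bridge_exponent hs ht, Real.exp_add]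
      ring

theorem lintegral_exp_neg_mul_sq_norm {b : ℝ} (hb : 0 < b) (m : Space d) :
    ∫⁻ z : Space d, ENNReal.ofReal ((Real.pi / b) ^ (-(d : ℝ) / 2) *
      Real.exp (-b * ‖z - m‖ ^ 2)) = 1 := by
  rw [lintegral_sub_right_eq_self (fun z : Space d => ENNReal.ofReal
    ((Real.pi / b) ^ (-(d : ℝ) / 2) * Real.exp (-b * ‖z‖ ^ 2))) m]
  have h := GaussianFourier.integral_rexp_neg_mul_sq_norm (V := Space d) hb
  have hpos : 0 < ∫ v : Space d, Real.exp (-b * ‖v‖ ^ 2) := by rw [h]; positivity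
  -- A nonintegrable function has Bochner integral `0` by default, so the positive value of the
  -- integral forces integrability.
  have hint : Integrable fun v : Space d => Real.exp (-b * ‖v‖ ^ 2) := by
    by_contra hc
    rw [integral_undef hc] at hpos
    exact lt_irrefl _ hpos
  rw [← ofReal_integral_eq_lintegral_ofReal (hint.const_mul _)
    (Eventually.of_forall fun v => by positivity), integral_const_mul, h,
    finrank_euclideanSpace_fin, ← Real.rpow_add (by positivity)]
  have : -(d : ℝ) / 2 + d / 2 = 0 := by ring
  rw [this, Real.rpow_zero, ENNReal.ofReal_one]

theorem isSemigroup_heat : IsSemigroup (heat d) := by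
  intro s t hs ht x y
  have h : ∀ z : Space d, heat d s x z * heat d t z y = ENNReal.ofReal (gauss (s + t) x y) *
      ENNReal.ofReal ((Real.pi / ((s + t) / (4 * s * t))) ^ (-(d : ℝ) / 2) *
        Real.exp (-((s + t) / (4 * s * t)) * ‖z - (x + (s / (s + t)) • (y - x))‖ ^ 2)) := by
    intro z
    rw [heat_of_pos hs, heat_of_pos ht, ← ENNReal.ofReal_mul (gauss_pos hs x z).le,
      gauss_mul_gauss hs ht, ENNReal.ofReal_mul (gauss_pos (add_pos hs ht) x y).le]
  simp_rw [h]
  rw [lintegral_const_mul' _ _ ENNReal.ofReal_ne_top,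
    lintegral_exp_neg_mul_sq_norm (by positivity), mul_one, heat_of_pos (add_pos hs ht)]

/-! ### Algebra of space-time compositions -/

theorem setLIntegral_Ioo_shift (f : ℝ → ℝ≥0∞) (a b c : ℝ) :
    ∫⁻ v in Ioo a b, f (c + v) = ∫⁻ s in Ioo (c + a) (c + b), f s := by
  rw [← lintegral_indicator measurableSet_Ioo, ← lintegral_indicator measurableSet_Ioo,
    ← lintegral_add_left_eq_self ((Ioo (c + a) (c + b)).indicator f) c]
  refine lintegral_congr fun v => ?_
  simp only [indicator, mem_Ioo, add_lt_add_iff_left]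

theorem setLIntegral_Ioo_triangle {Φ : ℝ → ℝ → ℝ≥0∞}
    (hΦ : Measurable fun p : ℝ × ℝ => Φ p.1 p.2) (t : ℝ) :
    ∫⁻ s in Ioo 0 t, ∫⁻ u in Ioo 0 s, Φ s u = ∫⁻ u in Ioo 0 t, ∫⁻ s in Ioo u t, Φ s u := by
  have h1 : ∀ s, (Ioo 0 t).indicator (fun s => ∫⁻ u in Ioo 0 s, Φ s u) s =
      ∫⁻ u, (if 0 < u ∧ u < s ∧ s < t then Φ s u else 0) := by
    intro s
    by_cases hs : s ∈ Ioo 0 t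
    · rw [indicator_of_mem hs, ← lintegral_indicator measurableSet_Ioo]
      refine lintegral_congr fun u => ?_
      simp only [indicator, mem_Ioo, hs.2, and_true]
    · rw [indicator_of_notMem hs]
      symm
      rw [lintegral_eq_zero_of_ae_eq_zero]
      refine Eventually.of_forall fun u => if_neg fun h => hs ⟨h.1.trans h.2.1, h.2.2⟩
  have h2 : ∀ u, (Ioo 0 t).indicator (fun u => ∫⁻ s in Ioo u t, Φ s u) u =
      ∫⁻ s, (if 0 < u ∧ u < s ∧ s < t then Φ s u else 0) := by
    intro u
    by_cases hu : u ∈ Ioo 0 t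
    · rw [indicator_of_mem hu, ← lintegral_indicator measurableSet_Ioo]
      refine lintegral_congr fun s => ?_
      simp only [indicator, mem_Ioo, hu.1, true_and]
    · rw [indicator_of_notMem hu]
      symm
      rw [lintegral_eq_zero_of_ae_eq_zero]
      refine Eventually.of_forall fun s => if_neg fun h => hu ⟨h.1, h.2.1.trans h.2.2⟩
  rw [← lintegral_indicator measurableSet_Ioo, ← lintegral_indicator measurableSet_Ioo]
  simp_rw [h1, h2]
  refine lintegral_lintegral_swap (Measurable.aemeasurable ?_)
  refine Measurable.ite ?_ hΦ measurable_const
  exact (measurableSet_lt measurable_const measurable_snd).inter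
    ((measurableSet_lt measurable_snd measurable_fst).inter
      (measurableSet_lt measurable_fst measurable_const))

theorem setLIntegral_Ioo_add {s t : ℝ} (hs : 0 ≤ s) (ht : 0 < t) (f : ℝ → ℝ≥0∞) :
    ∫⁻ u in Ioo 0 (s + t), f u = (∫⁻ u in Ioo 0 s, f u) + ∫⁻ u in Ioo 0 t, f (s + u) := by
  rw [setLIntegral_Ioo_shift, add_zero, setLIntegral_congr Ioo_ae_eq_Ioc,
    setLIntegral_congr (Ioo_ae_eq_Ioc (a := (0 : ℝ)) (b := s)),
    setLIntegral_congr (Ioo_ae_eq_Ioc (a := s)),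
    ← Ioc_union_Ioc_eq_Ioc hs (by linarith : s ≤ s + t),
    lintegral_union measurableSet_Ioc]
  exact Ioc_disjoint_Ioc_of_le le_rfl

section Algebra

variable {A A' B B' C : TimeKernel d} {q r : Space d → ℝ≥0∞}

theorem MeasKer.conv (hA : MeasKer A) (hq : Measurable q) (hB : MeasKer B) :
    MeasKer (conv A q B) := by
  unfold MeasKer Schroedinger.conv at *
  simp_rw [← lintegral_indicator measurableSet_Ioo]
  refine Measurable.lintegral_prod_right'
    (f := fun p : (ℝ × Space d × Space d) × ℝ => (Ioo 0 p.1.1).indicator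
      (fun s => ∫⁻ z, A s p.1.2.1 z * q z * B (p.1.1 - s) z p.1.2.2) p.2) ?_
  refine Measurable.ite (p := fun p : (ℝ × Space d × Space d) × ℝ => p.2 ∈ Ioo 0 p.1.1) ?_
    (by fun_prop) measurable_const
  exact (measurableSet_lt measurable_const measurable_snd).inter
    (measurableSet_lt measurable_snd (by fun_prop))

theorem MeasKer.add (hA : MeasKer A) (hB : MeasKer B) : MeasKer (A + B) :=
  Measurable.add hA hB

theorem conv_of_nonpos {t : ℝ} (ht : t ≤ 0) (x y : Space d) : conv A q B t x y = 0 := by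
  unfold conv
  rw [Ioo_eq_empty (not_lt.2 ht), Measure.restrict_empty, lintegral_zero_measure]

theorem conv_mono {t : ℝ} {x y : Space d} (hA : ∀ s ∈ Ioo 0 t, ∀ z, A s x z ≤ A' s x z)
    (hq : ∀ z, q z ≤ r z) (hB : ∀ s ∈ Ioo 0 t, ∀ z, B s z y ≤ B' s z y) :
    conv A q B t x y ≤ conv A' r B' t x y := by
  refine setLIntegral_mono' measurableSet_Ioo fun s hs => lintegral_mono fun z => ?_
  exact mul_le_mul' (mul_le_mul' (hA s hs z) (hq z))
    (hB _ ⟨sub_pos.2 hs.2, sub_lt_self _ hs.1⟩ z)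

theorem conv_congr {t : ℝ} {x y : Space d} (hA : ∀ s ∈ Ioo 0 t, ∀ z, A s x z = A' s x z)
    (hq : ∀ z, q z = r z) (hB : ∀ s ∈ Ioo 0 t, ∀ z, B s z y = B' s z y) :
    conv A q B t x y = conv A' r B' t x y :=
  le_antisymm (conv_mono (fun s hs z => (hA s hs z).le) (fun z => (hq z).le)
      fun s hs z => (hB s hs z).le)
    (conv_mono (fun s hs z => (hA s hs z).ge) (fun z => (hq z).ge) fun s hs z => (hB s hs z).ge)

theorem conv_add_left (hA : MeasKer A) (hq : Measurable q) (hB : MeasKer B) :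
    conv (A + A') q B = conv A q B + conv A' q B := by
  funext t x y
  simp only [conv, Pi.add_apply, add_mul]
  unfold MeasKer at *
  rw [← lintegral_add_left (by fun_prop)]
  refine lintegral_congr fun s => ?_
  rw [← lintegral_add_left (by fun_prop)]

theorem conv_add_mid (hA : MeasKer A) (hq : Measurable q) (hB : MeasKer B) :
    conv A (q + r) B = conv A q B + conv A r B := by
  funext t x y
  simp only [conv, Pi.add_apply, add_mul, mul_add]
  unfold MeasKer at *
  rw [← lintegral_add_left (by fun_prop)]
  refine lintegral_congr fun s => ?_
  rw [← lintegral_add_left (by fun_prop)]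

theorem conv_add_right (hA : MeasKer A) (hq : Measurable q) (hB : MeasKer B) :
    conv A q (B + B') = conv A q B + conv A q B' := by
  funext t x y
  simp only [conv, Pi.add_apply, mul_add]
  unfold MeasKer at *
  rw [← lintegral_add_left (by fun_prop)]
  refine lintegral_congr fun s => ?_
  rw [← lintegral_add_left (by fun_prop)]

/-- By Tonelli, both sides integrate the same function over the triangle `0 < u < s < t`; on the
right the inner time is shifted by `u`. -/
theorem conv_assoc (hA : MeasKer A) (hq : Measurable q) (hB : MeasKer B) (hr : Measurable r)
    (hC : MeasKer C) : conv (conv A q B) r C = conv A q (conv B r C) := by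
  funext t x y
  have hAB : MeasKer (conv A q B) := hA.conv hq hB
  unfold MeasKer at hA hB hC hAB
  set Φ : ℝ → ℝ → ℝ≥0∞ := fun s u => ∫⁻ w, ∫⁻ z,
    A u x w * q w * (B (s - u) w z * r z * C (t - s) z y) with hΦ
  have hΦm : Measurable fun p : ℝ × ℝ => Φ p.1 p.2 := by fun_prop
  have h1 : conv (conv A q B) r C t x y = ∫⁻ s in Ioo 0 t, ∫⁻ u in Ioo 0 s, Φ s u := by
    refine lintegral_congr fun s => ?_
    have : ∀ z, conv A q B s x z * r z * C (t - s) z y = ∫⁻ u in Ioo 0 s, ∫⁻ w,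
        A u x w * q w * (B (s - u) w z * r z * C (t - s) z y) := by
      intro z
      unfold conv
      rw [mul_assoc, ← lintegral_mul_const _ (by fun_prop)]
      refine lintegral_congr fun u => ?_
      rw [← lintegral_mul_const _ (by fun_prop)]
      exact lintegral_congr fun w => by ring
    simp_rw [this]
    rw [lintegral_lintegral_swap (Measurable.aemeasurable (by fun_prop))]
    refine lintegral_congr fun u => ?_
    rw [lintegral_lintegral_swap (Measurable.aemeasurable (by fun_prop))]
  have h2 : conv A q (conv B r C) t x y = ∫⁻ u in Ioo 0 t, ∫⁻ s in Ioo u t, Φ s u := by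
    refine lintegral_congr fun u => ?_
    have : ∀ w, A u x w * q w * conv B r C (t - u) w y = ∫⁻ v in Ioo 0 (t - u), ∫⁻ z,
        A u x w * q w * (B v w z * r z * C (t - u - v) z y) := by
      intro w
      unfold conv
      rw [← lintegral_const_mul _ (by fun_prop)]
      refine lintegral_congr fun v => ?_
      rw [← lintegral_const_mul _ (by fun_prop)]
    simp_rw [this]
    rw [lintegral_lintegral_swap (Measurable.aemeasurable (by fun_prop))]
    have h3 := setLIntegral_Ioo_shift (fun s => Φ s u) 0 (t - u) u
    rw [add_zero, add_sub_cancel] at h3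
    rw [← h3]
    refine lintegral_congr fun v => ?_
    simp only [hΦ, add_sub_cancel_left, sub_sub]
  rw [h1, h2, setLIntegral_Ioo_triangle hΦm]

theorem conv_iSup_left {P : ℕ → TimeKernel d} (hP : ∀ n, MeasKer (P n))
    (hmono : ∀ t x y, Monotone fun n => P n t x y) (hq : Measurable q) (hB : MeasKer B)
    (t : ℝ) (x y : Space d) :
    conv (fun t x y => ⨆ n, P n t x y) q B t x y = ⨆ n, conv (P n) q B t x y := by
  unfold MeasKer at *
  unfold conv
  rw [← lintegral_iSup (fun n => by have := hP n; fun_prop)]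
  · refine lintegral_congr fun s => ?_
    rw [← lintegral_iSup (fun n => by have := hP n; fun_prop)]
    · simp_rw [ENNReal.iSup_mul]
    · intro m n hmn z
      exact mul_le_mul_left (mul_le_mul_left (hmono _ _ _ hmn) _) _
  · intro m n hmn s
    exact lintegral_mono fun z => mul_le_mul_left (mul_le_mul_left (hmono _ _ _ hmn) _) _

theorem conv_iSup_right {P : ℕ → TimeKernel d} (hP : ∀ n, MeasKer (P n))
    (hmono : ∀ t x y, Monotone fun n => P n t x y) (hq : Measurable q) (hA : MeasKer A)
    (t : ℝ) (x y : Space d) :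
    conv A q (fun t x y => ⨆ n, P n t x y) t x y = ⨆ n, conv A q (P n) t x y := by
  unfold MeasKer at *
  unfold conv
  rw [← lintegral_iSup (fun n => by have := hP n; fun_prop)]
  · refine lintegral_congr fun s => ?_
    rw [← lintegral_iSup (fun n => by have := hP n; fun_prop)]
    · simp_rw [ENNReal.mul_iSup]
    · intro m n hmn z
      exact mul_le_mul_right (hmono _ _ _ hmn) _
  · intro m n hmn s
    exact lintegral_mono fun z => mul_le_mul_right (hmono _ _ _ hmn) _

/-- Composition with a semigroup in the last factor splits at an intermediate time. -/
theorem conv_split {b : TimeKernel d} (hA : MeasKer A) (hq : Measurable q) (hb : MeasKer b)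
    (hsg : IsSemigroup b) {s t : ℝ} (hs : 0 < s) (ht : 0 < t) (x y : Space d) :
    conv A q b (s + t) x y = (∫⁻ z, conv A q b s x z * b t z y) +
      conv (fun u x w => A (s + u) x w) q b t x y := by
  have hAb := hA.conv hq hb
  unfold MeasKer at hA hb hAb
  unfold conv
  rw [setLIntegral_Ioo_add hs.le ht]
  congr 1
  · have : ∀ z, (∫⁻ u in Ioo 0 s, ∫⁻ w, A u x w * q w * b (s - u) w z) * b t z y =
        ∫⁻ u in Ioo 0 s, ∫⁻ w, A u x w * q w * (b (s - u) w z * b t z y) := by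
      intro z
      rw [← lintegral_mul_const _ (by fun_prop)]
      refine lintegral_congr fun u => ?_
      rw [← lintegral_mul_const _ (by fun_prop)]
      exact lintegral_congr fun w => by ring
    simp_rw [this]
    symm
    rw [lintegral_lintegral_swap (Measurable.aemeasurable (by fun_prop))]
    refine setLIntegral_congr_fun (measurableSet_Ioo (a := (0 : ℝ)) (b := s)) fun u hu => ?_
    rw [lintegral_lintegral_swap (Measurable.aemeasurable (by fun_prop))]
    refine lintegral_congr fun w => ?_
    rw [lintegral_const_mul _ (by fun_prop), hsg (s - u) t (sub_pos.2 hu.2) ht]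
    congr 2
    ring
  · refine lintegral_congr fun u => lintegral_congr fun w => ?_
    congr 2
    ring

theorem lintegral_mul_conv (hA : MeasKer A) (hB : MeasKer B) (hq : Measurable q)
    (hC : MeasKer C) (s t : ℝ) (x y : Space d) :
    ∫⁻ z, A s x z * conv B q C t z y =
      conv (fun u x w => ∫⁻ z, A s x z * B u z w) q C t x y := by
  have hBC := hB.conv hq hC
  unfold MeasKer at hA hB hC hBC
  unfold conv
  have : ∀ z, A s x z * (∫⁻ u in Ioo 0 t, ∫⁻ w, B u z w * q w * C (t - u) w y) =
      ∫⁻ u in Ioo 0 t, ∫⁻ w, A s x z * B u z w * (q w * C (t - u) w y) := by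
    intro z
    rw [← lintegral_const_mul _ (by fun_prop)]
    refine lintegral_congr fun u => ?_
    rw [← lintegral_const_mul _ (by fun_prop)]
    exact lintegral_congr fun w => by ring
  simp_rw [this]
  rw [lintegral_lintegral_swap (Measurable.aemeasurable (by fun_prop))]
  refine lintegral_congr fun u => ?_
  rw [lintegral_lintegral_swap (Measurable.aemeasurable (by fun_prop))]
  refine lintegral_congr fun w => ?_
  rw [lintegral_mul_const _ (by fun_prop), mul_assoc]

end Algebra

/-! ### Killing at a constant rate -/

theorem setLIntegral_Ioo_ofReal_of_hasDerivAt {F f : ℝ → ℝ} {t : ℝ} (ht : 0 ≤ t)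
    (hF : ∀ s, HasDerivAt F (f s) s) (hf : Continuous f) (h0 : ∀ s ∈ Ioo 0 t, 0 ≤ f s) :
    ∫⁻ s in Ioo 0 t, ENNReal.ofReal (f s) = ENNReal.ofReal (F t - F 0) := by
  rw [← intervalIntegral.integral_eq_sub_of_hasDerivAt (fun s _ => hF s)
    (hf.intervalIntegrable 0 t), intervalIntegral.integral_of_le ht,
    setIntegral_congr_set Ioo_ae_eq_Ioc.symm, ofReal_integral_eq_lintegral_ofReal]
  · exact (hf.integrableOn_Icc (a := 0) (b := t)).mono_set Ioo_subset_Icc_self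
  · exact (ae_restrict_iff' measurableSet_Ioo).2 (Eventually.of_forall h0)

/-- At each time `s` Chapman-Kolmogorov collapses the space integral to `g(t,x,y)`, so only a time
integral remains. -/
theorem conv_const_mul_heat {φ ψ : ℝ → ℝ≥0∞} (hφ : Measurable φ) (hψ : Measurable ψ)
    (M : ℝ≥0∞) (t : ℝ) (x y : Space d) :
    conv (fun s x z => φ s * heat d s x z) (fun _ => M) (fun s z y => ψ s * heat d s z y) t x y =
      (∫⁻ s in Ioo 0 t, φ s * M * ψ (t - s)) * heat d t x y := by
  have hm := measKer_heat (d := d)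
  unfold MeasKer at hm
  unfold conv
  rw [← lintegral_mul_const _ (by fun_prop)]
  refine setLIntegral_congr_fun measurableSet_Ioo fun s hs => ?_
  have : ∀ z, φ s * heat d s x z * M * (ψ (t - s) * heat d (t - s) z y) =
      (φ s * M * ψ (t - s)) * (heat d s x z * heat d (t - s) z y) := fun z => by ring
  simp_rw [this]
  rw [lintegral_const_mul _ (by fun_prop), isSemigroup_heat s (t - s) hs.1 (sub_pos.2 hs.2),
    add_sub_cancel]

theorem conv_heat_const_heat (M : ℝ≥0) (t : ℝ) (x y : Space d) :
    conv (heat d) (fun _ => (M : ℝ≥0∞)) (heat d) t x y =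
      M * ENNReal.ofReal t * heat d t x y := by
  have h := conv_const_mul_heat (d := d) (φ := fun _ => 1) (ψ := fun _ => 1) measurable_const
    measurable_const (M : ℝ≥0∞) t x y
  simp only [one_mul, mul_one, lintegral_const, Measure.restrict_apply_univ, Real.volume_Ioo,
    sub_zero] at h
  exact h

/-- The heat kernel killed at the constant rate `M`. -/
noncomputable def dampedHeat (d : ℕ) (M : ℝ≥0) : TimeKernel d :=
  fun t x y => ENNReal.ofReal (Real.exp (-M * t)) * heat d t x y

theorem measKer_dampedHeat (M : ℝ≥0) : MeasKer (dampedHeat d M) := by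
  have hm := measKer_heat (d := d)
  unfold MeasKer dampedHeat at *
  fun_prop

theorem isSemigroup_dampedHeat (M : ℝ≥0) : IsSemigroup (dampedHeat d M) := by
  intro s t hs ht x y
  have hm := measKer_heat (d := d)
  unfold MeasKer at hm
  have : ∀ z, dampedHeat d M s x z * dampedHeat d M t z y =
      ENNReal.ofReal (Real.exp (-M * (s + t))) * (heat d s x z * heat d t z y) := by
    intro z
    unfold dampedHeat
    rw [mul_add, Real.exp_add, ENNReal.ofReal_mul (Real.exp_pos _).le]
    ring
  simp_rw [this]
  rw [lintegral_const_mul _ (by fun_prop), isSemigroup_heat s t hs ht, dampedHeat]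

theorem heat_of_nonpos {t : ℝ} (ht : t ≤ 0) (x y : Space d) : heat d t x y = 0 :=
  if_neg (not_lt.2 ht)

/-- The common end of both Duhamel formulas for the damped kernel: `c` stands for the time integral,
and at `t ≤ 0` every kernel vanishes. -/
theorem dampedHeat_add_aux {M : ℝ≥0} {t : ℝ} {c : ℝ≥0∞} (x y : Space d)
    (h : 0 < t → c = ENNReal.ofReal (1 - Real.exp (-M * t))) :
    dampedHeat d M t x y + c * heat d t x y = heat d t x y := by
  rcases le_or_gt t 0 with ht | ht
  · simp [dampedHeat, heat_of_nonpos ht]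
  · have : Real.exp (-M * t) ≤ 1 := Real.exp_le_one_iff.2 (by
      rw [neg_mul]; exact neg_nonpos.2 (by positivity))
    rw [h ht, dampedHeat, ← add_mul, ← ENNReal.ofReal_add (Real.exp_pos _).le (by linarith)]
    simp

theorem dampedHeat_add_conv_left (M : ℝ≥0) :
    dampedHeat d M + conv (dampedHeat d M) (fun _ => (M : ℝ≥0∞)) (heat d) = heat d := by
  funext t x y
  have h := conv_const_mul_heat (d := d) (φ := fun s => ENNReal.ofReal (Real.exp (-M * s)))
    (ψ := fun _ => 1) (by fun_prop) measurable_const (M : ℝ≥0∞) t x y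
  simp only [one_mul, mul_one] at h
  change dampedHeat d M t x y +
    conv (fun s x z => ENNReal.ofReal (Real.exp (-M * s)) * heat d s x z) _
      (fun s x z => heat d s x z) t x y = _
  rw [h]
  refine dampedHeat_add_aux x y fun ht => ?_
  have h2 := setLIntegral_Ioo_ofReal_of_hasDerivAt (F := fun s => -Real.exp (-M * s))
    (f := fun s => Real.exp (-M * s) * M) ht.le (fun s => ?_) (by fun_prop)
    (fun s _ => by positivity)
  · convert h2 using 1
    · refine lintegral_congr fun s => ?_
      rw [ENNReal.ofReal_mul (Real.exp_pos _).le, ENNReal.ofReal_coe_nnreal]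
    · congr 1
      simp
      ring
  · have := (((hasDerivAt_id' s).const_mul (-M : ℝ)).exp).fun_neg
    simpa using this

theorem dampedHeat_add_conv_right (M : ℝ≥0) :
    dampedHeat d M + conv (heat d) (fun _ => (M : ℝ≥0∞)) (dampedHeat d M) = heat d := by
  funext t x y
  have h := conv_const_mul_heat (d := d) (ψ := fun s => ENNReal.ofReal (Real.exp (-M * s)))
    (φ := fun _ => 1) measurable_const (by fun_prop) (M : ℝ≥0∞) t x y
  simp only [one_mul] at h
  change dampedHeat d M t x y +
    conv (fun s x z => heat d s x z) _
      (fun s x z => ENNReal.ofReal (Real.exp (-M * s)) * heat d s x z) t x y = _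
  rw [h]
  refine dampedHeat_add_aux x y fun ht => ?_
  have h2 := setLIntegral_Ioo_ofReal_of_hasDerivAt (F := fun s => Real.exp (-M * (t - s)))
    (f := fun s => M * Real.exp (-M * (t - s))) ht.le (fun s => ?_) (by fun_prop)
    (fun s _ => by positivity)
  · convert h2 using 1
    · refine lintegral_congr fun s => ?_
      rw [ENNReal.ofReal_mul (by positivity), ENNReal.ofReal_coe_nnreal]
    · simp
  · have := ((((hasDerivAt_id' s).const_sub t).const_mul (-M : ℝ)).exp)
    convert this using 1
    ring

/-! ### Positive perturbations -/

/-- Picard iterates of `P = b + ∫∫ P r b`, started at `0`. -/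
noncomputable def picard (b : TimeKernel d) (r : Space d → ℝ≥0∞) : ℕ → TimeKernel d
  | 0 => 0
  | n + 1 => b + conv (picard b r n) r b

/-- The positive perturbation of `b` by `r`: the minimal solution of `P = b + ∫∫ P r b`. -/
noncomputable def perturb (b : TimeKernel d) (r : Space d → ℝ≥0∞) : TimeKernel d :=
  fun t x y => ⨆ n, picard b r n t x y

section Perturb

variable {b : TimeKernel d} {r : Space d → ℝ≥0∞}

theorem measKer_picard (hb : MeasKer b) (hr : Measurable r) : ∀ n, MeasKer (picard b r n)
  | 0 => measurable_const
  | n + 1 => hb.add ((measKer_picard hb hr n).conv hr hb)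

theorem measKer_perturb (hb : MeasKer b) (hr : Measurable r) : MeasKer (perturb b r) :=
  Measurable.iSup fun n => measKer_picard hb hr n

theorem picard_le_succ (b : TimeKernel d) (r : Space d → ℝ≥0∞) :
    ∀ n t x y, picard b r n t x y ≤ picard b r (n + 1) t x y
  | 0, _, _, _ => zero_le
  | n + 1, _, _, _ => add_le_add_right
      (conv_mono (fun s _ z => picard_le_succ b r n s _ z) (fun _ => le_rfl) fun _ _ _ => le_rfl) _

theorem monotone_picard (b : TimeKernel d) (r : Space d → ℝ≥0∞) (t : ℝ) (x y : Space d) :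
    Monotone fun n => picard b r n t x y :=
  monotone_nat_of_le_succ fun n => picard_le_succ b r n t x y

/-- Both recursions sum the same words `b r b ⋯ r b`, by associativity; this gives the limit an
equation on the right as well. -/
theorem picard_succ_right (hb : MeasKer b) (hr : Measurable r) :
    ∀ n, picard b r (n + 1) = b + conv b r (picard b r n)
  | 0 => by
    funext t x y
    simp [picard, conv]
  | n + 1 => by
    have ih := picard_succ_right hb hr n
    have hP := measKer_picard hb hr n
    rw [picard, ih, conv_add_left hb hr hb, conv_assoc hb hr hP hr hb,
      ← conv_add_right hb hr hb, ← picard, ih]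

theorem perturb_eq_left (hb : MeasKer b) (hr : Measurable r) :
    perturb b r = b + conv (perturb b r) r b := by
  funext t x y
  change (⨆ n, picard b r n t x y) = b t x y + conv (perturb b r) r b t x y
  unfold perturb
  rw [conv_iSup_left (measKer_picard hb hr) (monotone_picard b r) hr hb, ENNReal.add_iSup,
    ← (monotone_picard b r t x y).iSup_nat_add 1]
  rfl

theorem perturb_eq_right (hb : MeasKer b) (hr : Measurable r) :
    perturb b r = b + conv b r (perturb b r) := by
  funext t x y
  change (⨆ n, picard b r n t x y) = b t x y + conv b r (perturb b r) t x y
  unfold perturb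
  rw [conv_iSup_right (measKer_picard hb hr) (monotone_picard b r) hr hb, ENNReal.add_iSup,
    ← (monotone_picard b r t x y).iSup_nat_add 1]
  simp_rw [picard_succ_right hb hr]
  rfl

/-- Induction on `n`: applying the hypothesis under the last composition replaces the product by
`perturb b r (s + u)`. The last jump at or before `s` and the last jump after `s` are then reunited
by `conv_split`. Only this inequality is needed for chaining lower bounds. -/
theorem lintegral_perturb_mul_picard_le (hb : MeasKer b) (hr : Measurable r)
    (hsg : IsSemigroup b) : ∀ n, ∀ s t : ℝ, 0 < s → 0 < t → ∀ x y,
      ∫⁻ z, perturb b r s x z * picard b r n t z y ≤ perturb b r (s + t) x y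
  | 0, s, t, _, _, x, y => by simp [picard]
  | n + 1, s, t, hs, ht, x, y => by
    have hK := measKer_perturb hb hr
    have hP := measKer_picard hb hr n
    have hKb := hK.conv hr hb
    have e := perturb_eq_left hb hr
    have e' : ∀ t x y, perturb b r t x y = b t x y + conv (perturb b r) r b t x y :=
      fun t x y => congrFun (congrFun (congrFun e t) x) y
    have h1 : ∫⁻ z, perturb b r s x z * b t z y =
        b (s + t) x y + ∫⁻ z, conv (perturb b r) r b s x z * b t z y := by
      rw [← hsg s t hs ht]
      unfold MeasKer at *
      rw [← lintegral_add_left (by fun_prop)]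
      refine lintegral_congr fun z => ?_
      rw [e' s x z, add_mul]
    calc ∫⁻ z, perturb b r s x z * picard b r (n + 1) t z y
        = (∫⁻ z, perturb b r s x z * b t z y) +
            ∫⁻ z, perturb b r s x z * conv (picard b r n) r b t z y := by
          unfold MeasKer at *
          rw [← lintegral_add_left (by fun_prop)]
          refine lintegral_congr fun z => ?_
          rw [← mul_add]
          rfl
      _ ≤ (∫⁻ z, perturb b r s x z * b t z y) +
            conv (fun u x w => perturb b r (s + u) x w) r b t x y := by
          rw [lintegral_mul_conv hK hP hr hb]
          refine add_le_add_right (conv_mono (fun u hu z => ?_) (fun _ => le_rfl)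
            fun _ _ _ => le_rfl) _
          exact lintegral_perturb_mul_picard_le hb hr hsg n s u hs hu.1 x z
      _ = perturb b r (s + t) x y := by
          rw [h1, add_assoc, ← conv_split hK hr hb hsg hs ht, ← e']

theorem lintegral_perturb_mul_perturb_le (hb : MeasKer b) (hr : Measurable r)
    (hsg : IsSemigroup b) {s t : ℝ} (hs : 0 < s) (ht : 0 < t) (x y : Space d) :
    ∫⁻ z, perturb b r s x z * perturb b r t z y ≤ perturb b r (s + t) x y := by
  have hK := measKer_perturb hb hr
  have h : ∀ z, perturb b r s x z * perturb b r t z y =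
      ⨆ n, perturb b r s x z * picard b r n t z y := fun z => ENNReal.mul_iSup _ _
  simp_rw [h]
  unfold MeasKer at *
  rw [lintegral_iSup (fun n => by
    have := measKer_picard hb hr n
    unfold MeasKer at this
    fun_prop)]
  · exact iSup_le fun n => lintegral_perturb_mul_picard_le hb hr hsg n s t hs ht x y
  · exact fun m n hmn z => mul_le_mul_right (monotone_picard b r t z y hmn) _

end Perturb

/-! ### Bounded killing: Duhamel formulas and the resolvent identity -/

/-- The perturbation of the heat kernel by `-q`, where `0 ≤ q ≤ M`: damping at rate `M` followed by
the positive perturbation by `M - q`. -/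
noncomputable def killedHeat (q : Space d → ℝ≥0∞) (M : ℝ≥0) : TimeKernel d :=
  perturb (dampedHeat d M) fun z => M - q z

theorem le_of_add_eq {A B C : TimeKernel d} (h : A + B = C) (t : ℝ) (x y : Space d) :
    B t x y ≤ C t x y := by
  subst h
  exact self_le_add_left _ _

section Killed

variable {q : Space d → ℝ≥0∞} {M : ℝ≥0}

theorem measKer_killedHeat (hq : Measurable q) : MeasKer (killedHeat q M) :=
  measKer_perturb (measKer_dampedHeat M) (measurable_const.sub hq)

/-- Since `M - q ≤ M`, each iterate is dominated using the formula `b + g M b = g` for the damped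
kernel `b`. -/
theorem picard_dampedHeat_le (q : Space d → ℝ≥0∞) (M : ℝ≥0) : ∀ n t x y,
    picard (dampedHeat d M) (fun z => M - q z) n t x y ≤ heat d t x y
  | 0, _, _, _ => zero_le
  | n + 1, t, x, y => by
    have h := congrFun (congrFun (congrFun (dampedHeat_add_conv_right (d := d) M) t) x) y
    rw [← h]
    exact add_le_add_right (conv_mono (fun s _ z => picard_dampedHeat_le q M n s x z)
      (fun _ => tsub_le_self) fun _ _ _ => le_rfl) _

theorem killedHeat_le (q : Space d → ℝ≥0∞) (M : ℝ≥0) (t : ℝ) (x y : Space d) :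
    killedHeat q M t x y ≤ heat d t x y :=
  iSup_le fun n => picard_dampedHeat_le q M n t x y

theorem conv_heat_le (hqM : ∀ z, q z ≤ M) (t : ℝ) (x y : Space d) :
    conv (heat d) q (heat d) t x y ≤ M * ENNReal.ofReal t * heat d t x y := by
  rw [← conv_heat_const_heat]
  exact conv_mono (fun _ _ _ => le_rfl) hqM fun _ _ _ => le_rfl

theorem conv_heat_ne_top (hqM : ∀ z, q z ≤ M) (t : ℝ) (x y : Space d) :
    conv (heat d) q (heat d) t x y ≠ ⊤ :=
  ne_top_of_le_ne_top (ENNReal.mul_ne_top (by finiteness) (heat_ne_top t x y))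
    (conv_heat_le hqM t x y)

/-- With `r = M - q`, `b` the damped kernel and `K = b + K r b`, one has `K r g + K q g = K M g = b
M g + K r (b M g)`. Expanding `K r g` by `g = b + b M g` and cancelling the finite term `K r (b M
g)` leaves `K r b + K q g = b M g`; adding `b` finishes. -/
theorem killedHeat_duhamel_left (hq : Measurable q) (hqM : ∀ z, q z ≤ M) :
    killedHeat q M + conv (killedHeat q M) q (heat d) = heat d := by
  have hb := measKer_dampedHeat (d := d) M
  have hg := measKer_heat (d := d)
  have hr : Measurable fun z => (M : ℝ≥0∞) - q z := measurable_const.sub hq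
  have hK := measKer_killedHeat (M := M) hq
  have hM : Measurable fun _ : Space d => (M : ℝ≥0∞) := measurable_const
  set r : Space d → ℝ≥0∞ := fun z => M - q z
  have hrq : (fun _ : Space d => (M : ℝ≥0∞)) = r + q := by
    funext z
    exact (tsub_add_cancel_of_le (hqM z)).symm
  have e1 := dampedHeat_add_conv_left (d := d) M
  have e2 : killedHeat q M = dampedHeat d M + conv (killedHeat q M) r (dampedHeat d M) :=
    perturb_eq_left hb hr
  have e3 : conv (killedHeat q M) r (heat d) = conv (killedHeat q M) r (dampedHeat d M) +
      conv (killedHeat q M) r (conv (dampedHeat d M) (fun _ => (M : ℝ≥0∞)) (heat d)) := by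
    rw [← conv_add_right hK hr hb, e1]
  have e4 : conv (killedHeat q M) r (heat d) + conv (killedHeat q M) q (heat d) =
      conv (dampedHeat d M) (fun _ => (M : ℝ≥0∞)) (heat d) +
        conv (killedHeat q M) r (conv (dampedHeat d M) (fun _ => (M : ℝ≥0∞)) (heat d)) := by
    rw [← conv_add_mid hK hr hg, ← hrq, ← conv_assoc hK hr hb hM hg, ← conv_add_left hb hM hg,
      ← e2]
  funext t x y
  have fin : conv (killedHeat q M) r (conv (dampedHeat d M) (fun _ => (M : ℝ≥0∞)) (heat d)) t x y
      ≠ ⊤ := by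
    refine ne_top_of_le_ne_top (conv_heat_ne_top (q := r) (M := M) (fun z => tsub_le_self) t x y)
      (conv_mono (fun s _ z => killedHeat_le q M s x z) (fun _ => le_rfl) fun s _ z => le_of_add_eq e1 _ _ _)
  have e1' := congrFun (congrFun (congrFun e1 t) x) y
  have e2' := congrFun (congrFun (congrFun e2 t) x) y
  have e3' := congrFun (congrFun (congrFun e3 t) x) y
  have e4' := congrFun (congrFun (congrFun e4 t) x) y
  simp only [Pi.add_apply] at e1' e2' e3' e4' ⊢
  rw [e3', add_right_comm] at e4'
  rw [e2', add_assoc, (ENNReal.add_left_inj fin).1 e4', e1']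

theorem killedHeat_duhamel_right (hq : Measurable q) (hqM : ∀ z, q z ≤ M) :
    killedHeat q M + conv (heat d) q (killedHeat q M) = heat d := by
  have hb := measKer_dampedHeat (d := d) M
  have hg := measKer_heat (d := d)
  have hr : Measurable fun z => (M : ℝ≥0∞) - q z := measurable_const.sub hq
  have hK := measKer_killedHeat (M := M) hq
  have hM : Measurable fun _ : Space d => (M : ℝ≥0∞) := measurable_const
  set r : Space d → ℝ≥0∞ := fun z => M - q z
  have hrq : (fun _ : Space d => (M : ℝ≥0∞)) = r + q := by
    funext z
    exact (tsub_add_cancel_of_le (hqM z)).symm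
  have e1 := dampedHeat_add_conv_right (d := d) M
  have e2 : killedHeat q M = dampedHeat d M + conv (dampedHeat d M) r (killedHeat q M) :=
    perturb_eq_right hb hr
  have e3 : conv (heat d) r (killedHeat q M) = conv (dampedHeat d M) r (killedHeat q M) +
      conv (conv (heat d) (fun _ => (M : ℝ≥0∞)) (dampedHeat d M)) r (killedHeat q M) := by
    rw [← conv_add_left hb hr hK, e1]
  have e4 : conv (heat d) r (killedHeat q M) + conv (heat d) q (killedHeat q M) =
      conv (heat d) (fun _ => (M : ℝ≥0∞)) (dampedHeat d M) +
        conv (conv (heat d) (fun _ => (M : ℝ≥0∞)) (dampedHeat d M)) r (killedHeat q M) := by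
    rw [← conv_add_mid hg hr hK, ← hrq, conv_assoc hg hM hb hr hK, ← conv_add_right hg hM hb,
      ← e2]
  funext t x y
  have fin : conv (conv (heat d) (fun _ => (M : ℝ≥0∞)) (dampedHeat d M)) r (killedHeat q M) t x y
      ≠ ⊤ := by
    refine ne_top_of_le_ne_top (conv_heat_ne_top (q := r) (M := M) (fun z => tsub_le_self) t x y)
      (conv_mono (fun s _ z => le_of_add_eq e1 _ _ _) (fun _ => le_rfl)
        fun s _ z => killedHeat_le q M s z y)
  have e1' := congrFun (congrFun (congrFun e1 t) x) y
  have e2' := congrFun (congrFun (congrFun e2 t) x) y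
  have e3' := congrFun (congrFun (congrFun e3 t) x) y
  have e4' := congrFun (congrFun (congrFun e4 t) x) y
  simp only [Pi.add_apply] at e1' e2' e3' e4' ⊢
  rw [e3', add_right_comm] at e4'
  rw [e2', add_assoc, (ENNReal.add_left_inj fin).1 e4', e1']

/-- The resolvent identity between perturbations by `-(q + ρ)` and by `-q`. -/
theorem resolvent_identity {H G : TimeKernel d} {q ρ : Space d → ℝ≥0∞} (hH : MeasKer H)
    (hG : MeasKer G) (hq : Measurable q) (hρ : Measurable ρ)
    (eH : H + conv H (q + ρ) (heat d) = heat d) (eG : G + conv (heat d) q G = heat d) :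
    G = H + conv H ρ G := by
  have hg := measKer_heat (d := d)
  rw [conv_add_mid hH hq hg] at eH
  have e1 : conv H q (heat d) = conv H q G + conv H q (conv (heat d) q G) := by
    rw [← conv_add_right hH hq hG, eG]
  have e2 : conv H ρ (heat d) = conv H ρ G + conv H ρ (conv (heat d) q G) := by
    rw [← conv_add_right hH hρ hG, eG]
  -- Reassociated, the three terms are `(H + H q g + H ρ g) q G`, and the bracket is `g` by `eH`.
  have e3 : conv H q G + (conv H q (conv (heat d) q G) + conv H ρ (conv (heat d) q G)) =
      conv (heat d) q G := by
    rw [← conv_assoc hH hq hg hq hG, ← conv_assoc hH hρ hg hq hG,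
      ← conv_add_left (hH.conv hq hg) hq hG, ← conv_add_left hH hq hG, eH]
  have e4 : (H + conv H ρ G) + conv (heat d) q G = G + conv (heat d) q G := by
    calc _ = H + (conv H q (heat d) + conv H ρ (heat d)) := by
          rw [e1, e2]
          nth_rw 1 [← e3]
          abel
      _ = _ := by rw [eH, eG]
  funext t x y
  have e5 := congrFun (congrFun (congrFun e4 t) x) y
  have fin : conv (heat d) q G t x y ≠ ⊤ :=
    ne_top_of_le_ne_top (heat_ne_top t x y) (le_of_add_eq eG t x y)
  exact ((ENNReal.add_left_inj fin).1 e5).symm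

end Killed

/-! ### Jensen's inequality without bridges -/

section

variable {q : Space d → ℝ≥0∞} {M : ℝ≥0}

/-- The potential met along a bridge is additive over consecutive time intervals; this drives both
the Jensen step and the subadditivity of `supBridge`. -/
theorem conv_heat_split (hq : Measurable q) {s t : ℝ} (hs : 0 < s) (ht : 0 < t) (x y : Space d) :
    conv (heat d) q (heat d) (s + t) x y =
      (∫⁻ z, conv (heat d) q (heat d) s x z * heat d t z y) +
        ∫⁻ z, heat d s x z * conv (heat d) q (heat d) t z y := by
  have hg := measKer_heat (d := d)
  rw [conv_split hg hq hg isSemigroup_heat hs ht, lintegral_mul_conv hg hg hq hg]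
  congr 1
  exact conv_congr (fun u hu w => (isSemigroup_heat s u hs hu.1 x w).symm) (fun _ => rfl)
    fun _ _ _ => rfl

/-- The expected potential along the bridge, as a real number. -/
noncomputable def bridgeReal (q : Space d → ℝ≥0∞) (t : ℝ) (x y : Space d) : ℝ :=
  (conv (heat d) q (heat d) t x y / heat d t x y).toReal

/-- The lower bound `g(t,x,y) exp(-S(t,x,y))`. -/
noncomputable def jensenLower (q : Space d → ℝ≥0∞) : TimeKernel d :=
  fun t x y => heat d t x y * ENNReal.ofReal (Real.exp (-bridgeReal q t x y))

theorem bridgeReal_nonneg (q : Space d → ℝ≥0∞) (t : ℝ) (x y : Space d) :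
    0 ≤ bridgeReal q t x y := ENNReal.toReal_nonneg

theorem heat_mul_bridgeReal (hqM : ∀ z, q z ≤ M) {t : ℝ} (ht : 0 < t) (x y : Space d) :
    heat d t x y * ENNReal.ofReal (bridgeReal q t x y) = conv (heat d) q (heat d) t x y := by
  rw [bridgeReal, ENNReal.ofReal_toReal
    (ENNReal.div_ne_top (conv_heat_ne_top hqM t x y) (heat_ne_zero ht x y)),
    ENNReal.mul_div_cancel (heat_ne_zero ht x y) (heat_ne_top t x y)]

theorem bridgeReal_le (hqM : ∀ z, q z ≤ M) {t : ℝ} (ht : 0 < t) (x y : Space d) :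
    bridgeReal q t x y ≤ M * t := by
  have h : conv (heat d) q (heat d) t x y / heat d t x y ≤ M * ENNReal.ofReal t :=
    ENNReal.div_le_of_le_mul (conv_heat_le hqM t x y)
  have h2 := ENNReal.toReal_mono (by finiteness) h
  rwa [ENNReal.toReal_mul, ENNReal.toReal_ofReal ht.le, ENNReal.coe_toReal] at h2

theorem measurable_bridgeReal (hq : Measurable q) :
    Measurable fun p : ℝ × Space d × Space d => bridgeReal q p.1 p.2.1 p.2.2 := by
  have hg := measKer_heat (d := d)
  have hc := hg.conv hq hg
  unfold MeasKer bridgeReal at *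
  fun_prop

/-- The tangent line of the convex function `a ↦ exp (-a)` at `m`, arranged so that all terms stay
nonnegative when `a` and `m` are. -/
theorem exp_neg_tangent_le (a m : ℝ) :
    Real.exp (-m) * (1 + m) ≤ Real.exp (-a) + Real.exp (-m) * a := by
  have h := Real.add_one_le_exp (m - a)
  have e : Real.exp (-a) = Real.exp (-m) * Real.exp (m - a) := by
    rw [← Real.exp_add]
    congr 1
    ring
  rw [e, ← mul_add]
  exact mul_le_mul_of_nonneg_left (by linarith) (Real.exp_pos _).le

/-- Jensen's inequality on the bridge: `g exp(-S)` is a subsemigroup. -/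
theorem jensenLower_add_le (hq : Measurable q) (hqM : ∀ z, q z ≤ M) {s t : ℝ} (hs : 0 < s)
    (ht : 0 < t) (x y : Space d) :
    jensenLower q (s + t) x y ≤ ∫⁻ z, jensenLower q s x z * jensenLower q t z y := by
  have hg := measKer_heat (d := d)
  have hc := hg.conv hq hg
  have hσ := measurable_bridgeReal (d := d) hq
  unfold MeasKer at hg hc
  have hst := add_pos hs ht
  -- The tangent is taken at the bridge mean `m`, so its linear part integrates to the finite
  -- quantity cancelled at the end.
  set m := bridgeReal q (s + t) x y with hm
  have hm0 : 0 ≤ m := bridgeReal_nonneg q _ x y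
  set E := ENNReal.ofReal (Real.exp (-m)) with hE
  have h1 : ∀ z, heat d s x z * heat d t z y * (E * ENNReal.ofReal (1 + m)) ≤
      jensenLower q s x z * jensenLower q t z y +
        E * (conv (heat d) q (heat d) s x z * heat d t z y +
          heat d s x z * conv (heat d) q (heat d) t z y) := by
    intro z
    have h2 := ENNReal.ofReal_le_ofReal
      (exp_neg_tangent_le (bridgeReal q s x z + bridgeReal q t z y) m)
    rw [ENNReal.ofReal_add (Real.exp_pos _).le (mul_nonneg (Real.exp_pos _).le
      (add_nonneg (bridgeReal_nonneg _ _ _ _) (bridgeReal_nonneg _ _ _ _))),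
      ENNReal.ofReal_mul (Real.exp_pos _).le, neg_add, Real.exp_add,
      ENNReal.ofReal_mul (Real.exp_pos _).le, ENNReal.ofReal_mul (Real.exp_pos _).le,
      ENNReal.ofReal_add (bridgeReal_nonneg _ _ _ _) (bridgeReal_nonneg _ _ _ _)] at h2
    refine (mul_le_mul_right h2 _).trans_eq ?_
    rw [← heat_mul_bridgeReal hqM hs, ← heat_mul_bridgeReal hqM ht]
    unfold jensenLower
    ring
  have h3 := lintegral_mono (μ := volume) h1
  rw [lintegral_mul_const _ (by fun_prop), isSemigroup_heat s t hs ht,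
    lintegral_add_right _ (by fun_prop), lintegral_const_mul _ (by fun_prop),
    lintegral_add_left (by fun_prop), ← conv_heat_split hq hs ht,
    ← heat_mul_bridgeReal hqM hst, ← hm,
    ENNReal.ofReal_add zero_le_one hm0, ENNReal.ofReal_one, mul_add, mul_add, mul_one] at h3
  have fin : heat d (s + t) x y * (E * ENNReal.ofReal m) ≠ ⊤ :=
    ENNReal.mul_ne_top (heat_ne_top _ _ _) (by finiteness)
  rw [mul_left_comm E] at h3
  exact (ENNReal.add_le_add_iff_right fin).1 h3

/-- Follows from `(1 - a)(1 + a + 2a²) = 1 + a²(1 - 2a) ≥ 1` and `1 + u ≤ exp u`. -/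
theorem exp_neg_sub_sq_le {a : ℝ} (h1 : a ≤ 1 / 2) :
    Real.exp (-(2 * a ^ 2)) * Real.exp (-a) ≤ 1 - a := by
  rw [← Real.exp_add, ← neg_add, Real.exp_neg]
  have h2 : 1 + a + 2 * a ^ 2 ≤ Real.exp (2 * a ^ 2 + a) := by
    linarith [Real.add_one_le_exp (2 * a ^ 2 + a)]
  rw [inv_le_comm₀ (Real.exp_pos _) (by linarith)]
  refine le_trans ?_ h2
  rw [inv_le_iff_one_le_mul₀ (by linarith)]
  nlinarith [mul_nonneg (sq_nonneg a) (by linarith : 0 ≤ 1 - 2 * a)]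

/-- Duhamel's formula and `killedHeat ≤ g` give `killedHeat ≥ g (1 - S)`; here `S ≤ M t ≤ 1/2`, so
the defect against `e^{-S}` is quadratic in `M t`. -/
theorem jensenLower_le_killedHeat_small (hq : Measurable q) (hqM : ∀ z, q z ≤ M) {t : ℝ}
    (ht : 0 < t) (htM : M * t ≤ 1 / 2) (x y : Space d) :
    ENNReal.ofReal (Real.exp (-(2 * (M * t) ^ 2))) * jensenLower q t x y ≤
      killedHeat q M t x y := by
  have hσ0 := bridgeReal_nonneg q t x y
  have hσ := bridgeReal_le hqM ht x y
  have h1 : heat d t x y ≤ killedHeat q M t x y + conv (heat d) q (heat d) t x y := by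
    have h := congrFun (congrFun (congrFun (killedHeat_duhamel_left hq hqM) t) x) y
    rw [← h]
    exact add_le_add_right (conv_mono (fun s _ z => killedHeat_le q M s x z) (fun _ => le_rfl)
      fun _ _ _ => le_rfl) _
  have h2 : heat d t x y * ENNReal.ofReal (1 - bridgeReal q t x y) ≤ killedHeat q M t x y := by
    rw [← ENNReal.add_le_add_iff_right (conv_heat_ne_top hqM t x y)]
    refine le_trans (le_of_eq ?_) h1
    rw [← heat_mul_bridgeReal hqM ht, ← mul_add, ← ENNReal.ofReal_add (by linarith) hσ0]
    simp
  refine le_trans ?_ h2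
  rw [jensenLower, mul_left_comm, ← ENNReal.ofReal_mul (Real.exp_pos _).le]
  refine mul_le_mul_right (ENNReal.ofReal_le_ofReal ?_) _
  refine le_trans ?_ (exp_neg_sub_sq_le (hσ.trans htM))
  refine mul_le_mul_of_nonneg_right (Real.exp_le_exp.2 ?_) (Real.exp_pos _).le
  have := pow_le_pow_left₀ hσ0 hσ 2
  linarith

theorem jensenLower_le_killedHeat_steps (hq : Measurable q) (hqM : ∀ z, q z ≤ M) {τ : ℝ}
    (hτ : 0 < τ) (hτM : M * τ ≤ 1 / 2) (n : ℕ) (x y : Space d) :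
    ENNReal.ofReal (Real.exp (-(2 * (M * τ) ^ 2))) ^ (n + 1) *
      jensenLower q ((n + 1) * τ) x y ≤ killedHeat q M ((n + 1) * τ) x y := by
  induction n generalizing x y with
  | zero => simpa using jensenLower_le_killedHeat_small hq hqM hτ hτM x y
  | succ n ih =>
    have hn : (0 : ℝ) < (n + 1) * τ := by positivity
    have hg := measKer_heat (d := d)
    have hσ := measurable_bridgeReal (d := d) hq
    unfold MeasKer at hg
    have e : ((n + 1 : ℕ) + 1 : ℝ) * τ = (n + 1) * τ + τ := by
      push_cast
      ring
    rw [e]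
    set c := ENNReal.ofReal (Real.exp (-(2 * (M * τ) ^ 2)))
    calc c ^ (n + 1 + 1) * jensenLower q ((n + 1) * τ + τ) x y
        ≤ c ^ (n + 1 + 1) *
            ∫⁻ z, jensenLower q ((n + 1) * τ) x z * jensenLower q τ z y :=
          mul_le_mul_right (jensenLower_add_le hq hqM hn hτ x y) _
      _ = ∫⁻ z, (c ^ (n + 1) * jensenLower q ((n + 1) * τ) x z) *
            (c * jensenLower q τ z y) := by
          rw [← lintegral_const_mul]
          · exact lintegral_congr fun z => by ring
          · unfold jensenLower
            fun_prop
      _ ≤ ∫⁻ z, killedHeat q M ((n + 1) * τ) x z * killedHeat q M τ z y :=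
          lintegral_mono fun z => mul_le_mul' (ih x z)
            (jensenLower_le_killedHeat_small hq hqM hτ hτM z y)
      _ ≤ killedHeat q M ((n + 1) * τ + τ) x y :=
          lintegral_perturb_mul_perturb_le (measKer_dampedHeat M) (measurable_const.sub hq)
            (isSemigroup_dampedHeat M) hn hτ x y

/-- Jensen's inequality for the Feynman-Kac functional of a bounded potential. -/
theorem jensenLower_le_killedHeat (hq : Measurable q) (hqM : ∀ z, q z ≤ M) {t : ℝ} (ht : 0 < t)
    (x y : Space d) : jensenLower q t x y ≤ killedHeat q M t x y := by
  have hinv : Tendsto (fun n : ℕ => 1 / ((n : ℝ) + 1)) atTop (𝓝 0) :=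
    tendsto_one_div_add_atTop_nhds_zero_nat
  have hev : ∀ᶠ n : ℕ in atTop, (M : ℝ) * t * (1 / ((n : ℝ) + 1)) ≤ 1 / 2 := by
    have := hinv.const_mul ((M : ℝ) * t)
    rw [mul_zero] at this
    exact this.eventually_le_const (by norm_num)
  have hlim : Tendsto (fun n : ℕ => ENNReal.ofReal
      (Real.exp (-(2 * ((M : ℝ) * t) ^ 2 * (1 / ((n : ℝ) + 1))))) * jensenLower q t x y) atTop
      (𝓝 (ENNReal.ofReal (Real.exp (-(2 * ((M : ℝ) * t) ^ 2 * 0))) * jensenLower q t x y)) := by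
    refine ENNReal.Tendsto.mul_const (ENNReal.tendsto_ofReal
      ((Real.continuous_exp.tendsto _).comp (hinv.const_mul _).neg)) (Or.inr ?_)
    exact ENNReal.mul_ne_top (heat_ne_top _ _ _) ENNReal.ofReal_ne_top
  rw [mul_zero, neg_zero, Real.exp_zero, ENNReal.ofReal_one, one_mul] at hlim
  refine le_of_tendsto hlim (hev.mono fun n hn => ?_)
  have hn0 : (0 : ℝ) < n + 1 := by positivity
  -- With `n + 1` steps of length `t / (n + 1)` the accumulated loss is `exp (-2 (M t)² / (n + 1))`,
  -- which tends to `1`.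
  have h := jensenLower_le_killedHeat_steps hq hqM (τ := t / (n + 1)) (by positivity)
    (by rwa [mul_div_assoc', div_eq_mul_one_div]) n x y
  rw [mul_div_cancel₀ _ hn0.ne', ← ENNReal.ofReal_pow (Real.exp_pos _).le, ← Real.exp_nat_mul] at h
  refine le_of_eq_of_le ?_ h
  congr 3
  push_cast
  field_simp

end

/-! ### Identification with the alternating series -/

section

variable {q : Space d → ℝ≥0∞} {M : ℝ≥0}

/-- Iterates of `A ↦ ∫∫ A q g`. -/
noncomputable def iterConv (q : Space d → ℝ≥0∞) (A : TimeKernel d) : ℕ → TimeKernel d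
  | 0 => A
  | k + 1 => conv (iterConv q A k) q (heat d)

theorem measKer_iterConv (hq : Measurable q) {A : TimeKernel d} (hA : MeasKer A) :
    ∀ k, MeasKer (iterConv q A k)
  | 0 => hA
  | k + 1 => (measKer_iterConv hq hA k).conv hq measKer_heat

theorem iterConv_add (hq : Measurable q) {A B : TimeKernel d} (hA : MeasKer A) :
    ∀ k, iterConv q (A + B) k = iterConv q A k + iterConv q B k
  | 0 => rfl
  | k + 1 => by
    rw [iterConv, iterConv_add hq hA k,
      conv_add_left (measKer_iterConv hq hA k) hq measKer_heat]
    rfl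

theorem iterConv_conv (A : TimeKernel d) :
    ∀ k, iterConv q (conv A q (heat d)) k = iterConv q A (k + 1)
  | 0 => rfl
  | k + 1 => by
    rw [iterConv, iterConv_conv A k]
    rfl

/-- Makes the alternating sum telescope: inserting `g = K + K q g` in the first factor writes each
series term as two consecutive iterates of `K`. -/
theorem iterConv_heat_eq (hq : Measurable q) {K : TimeKernel d} (hK : MeasKer K)
    (e : K + conv K q (heat d) = heat d) (k : ℕ) :
    iterConv q (heat d) k = iterConv q K k + iterConv q K (k + 1) := by
  nth_rw 1 [← e]
  rw [iterConv_add hq hK, iterConv_conv]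

theorem seriesTerm_eq_iterConv (q : Space d → ℝ≥0∞) : ∀ k : ℕ, ∀ t : ℝ, 0 < t → ∀ x y,
    seriesTerm q k t x y = iterConv q (heat d) k t x y
  | 0, t, ht, x, y => (heat_of_pos ht x y).symm
  | k + 1, t, ht, x, y => by
    refine setLIntegral_congr_fun measurableSet_Ioo fun s hs => lintegral_congr fun z => ?_
    rw [seriesTerm_eq_iterConv q k s hs.1, heat_of_pos (sub_pos.2 hs.2)]

theorem iterConv_heat_le (hqM : ∀ z, q z ≤ M) : ∀ k : ℕ, ∀ t : ℝ, 0 < t → ∀ x y,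
    iterConv q (heat d) k t x y ≤
      ENNReal.ofReal ((M * t) ^ k / k.factorial) * heat d t x y
  | 0, t, ht, x, y => by simp [iterConv]
  | k + 1, t, ht, x, y => by
    have h := conv_const_mul_heat (d := d)
      (φ := fun s => ENNReal.ofReal ((M * s) ^ k / k.factorial)) (ψ := fun _ => 1)
      (by fun_prop) measurable_const (M : ℝ≥0∞) t x y
    simp only [one_mul, mul_one] at h
    calc iterConv q (heat d) (k + 1) t x y
        ≤ conv (fun s x z => ENNReal.ofReal ((M * s) ^ k / k.factorial) * heat d s x z)
            (fun _ => (M : ℝ≥0∞)) (fun s x z => heat d s x z) t x y :=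
          conv_mono (fun s hs z => iterConv_heat_le hqM k s hs.1 x z) hqM fun _ _ _ => le_rfl
      _ = _ := by
        rw [h]
        congr 1
        have h2 := setLIntegral_Ioo_ofReal_of_hasDerivAt
          (F := fun s => ((M : ℝ) * s) ^ (k + 1) / (k + 1).factorial)
          (f := fun s => (M * s) ^ k / k.factorial * M) ht.le (fun s => ?_) (by fun_prop)
          (fun s hs => by have := hs.1.le; positivity)
        · convert h2 using 1
          · refine setLIntegral_congr_fun measurableSet_Ioo fun s hs => ?_
            have := hs.1.le
            rw [ENNReal.ofReal_mul (by positivity), ENNReal.ofReal_coe_nnreal]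
          · simp
        · have := (((hasDerivAt_id' s).const_mul (M : ℝ)).fun_pow (k + 1)).div_const
            ((k + 1).factorial : ℝ)
          refine this.congr_deriv ?_
          rw [Nat.factorial_succ]
          push_cast
          field_simp

/-- A solution of the Duhamel formula for a bounded potential is the sum of the alternating
perturbation series. -/
theorem hasSum_seriesTerm (hq : Measurable q) (hqM : ∀ z, q z ≤ M) {K : TimeKernel d}
    (hK : MeasKer K) (e : K + conv K q (heat d) = heat d) {t : ℝ} (ht : 0 < t) (x y : Space d) :
    HasSum (fun k : ℕ => (-1 : ℝ) ^ k * (seriesTerm q k t x y).toReal) (K t x y).toReal := by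
  have hpb := fun k => iterConv_heat_le (d := d) hqM k t ht x y
  have hp : ∀ k, iterConv q (heat d) k t x y ≠ ⊤ := fun k =>
    ne_top_of_le_ne_top (ENNReal.mul_ne_top ENNReal.ofReal_ne_top (heat_ne_top t x y)) (hpb k)
  have hsplit : ∀ k, iterConv q (heat d) k t x y = iterConv q K k t x y +
      iterConv q K (k + 1) t x y := fun k =>
    congrFun (congrFun (congrFun (iterConv_heat_eq hq hK e k) t) x) y
  have ha : ∀ k, iterConv q K k t x y ≤ iterConv q (heat d) k t x y := fun k => by
    rw [hsplit]
    exact le_self_add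
  have hat : ∀ k, iterConv q K k t x y ≠ ⊤ := fun k => ne_top_of_le_ne_top (hp k) (ha k)
  set G := (heat d t x y).toReal
  have hbound : ∀ k, (iterConv q (heat d) k t x y).toReal ≤
      ((M : ℝ) * t) ^ k / k.factorial * G := fun k => by
    have := ENNReal.toReal_mono
      (ENNReal.mul_ne_top ENNReal.ofReal_ne_top (heat_ne_top t x y)) (hpb k)
    rwa [ENNReal.toReal_mul, ENNReal.toReal_ofReal (by positivity)] at this
  have hsum : Summable fun k : ℕ => ((M : ℝ) * t) ^ k / k.factorial * G :=
    (Real.summable_pow_div_factorial _).mul_right _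
  have hs : Summable fun k : ℕ => (-1 : ℝ) ^ k * (seriesTerm q k t x y).toReal := by
    refine Summable.of_norm_bounded hsum fun k => ?_
    rw [norm_mul, norm_pow, norm_neg, norm_one, one_pow, one_mul, Real.norm_eq_abs,
      abs_of_nonneg ENNReal.toReal_nonneg, seriesTerm_eq_iterConv q k t ht]
    exact hbound k
  have hpart : ∀ N, ∑ k ∈ Finset.range N, (-1 : ℝ) ^ k * (seriesTerm q k t x y).toReal =
      (K t x y).toReal - (-1) ^ N * (iterConv q K N t x y).toReal := by
    intro N
    induction N with
    | zero => simp [iterConv]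
    | succ N ih =>
      rw [Finset.sum_range_succ, ih, seriesTerm_eq_iterConv q N t ht, hsplit,
        ENNReal.toReal_add (hat N) (hat (N + 1))]
      ring
  refine (hs.hasSum_iff_tendsto_nat).2 ?_
  simp_rw [hpart]
  have hz : Tendsto (fun N : ℕ => (-1 : ℝ) ^ N * (iterConv q K N t x y).toReal) atTop (𝓝 0) := by
    refine squeeze_zero_norm (fun N => ?_) hsum.tendsto_atTop_zero
    rw [norm_mul, norm_pow, norm_neg, norm_one, one_pow, one_mul, Real.norm_eq_abs,
      abs_of_nonneg ENNReal.toReal_nonneg]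
    exact (ENNReal.toReal_mono (hp N) (ha N)).trans (hbound N)
  simpa using hz.const_sub (K t x y).toReal

end

/-! ### Unbounded potentials: truncation and limit -/

section

variable {q : Space d → ℝ≥0∞}

/-- Truncation of a nonnegative potential at height `n`. -/
noncomputable def truncPot (q : Space d → ℝ≥0∞) (n : ℕ) : Space d → ℝ≥0∞ := fun z => min (q z) n

/-- The perturbation of the heat kernel by `-min q n`. -/
noncomputable def truncHeat (q : Space d → ℝ≥0∞) (n : ℕ) : TimeKernel d :=
  killedHeat (truncPot q n) n

/-- The decreasing limit of the kernels `truncHeat q n`. -/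
noncomputable def limitHeat (q : Space d → ℝ≥0∞) : TimeKernel d :=
  fun t x y => ⨅ n, truncHeat q n t x y

theorem truncPot_le (q : Space d → ℝ≥0∞) (n : ℕ) (z : Space d) :
    truncPot q n z ≤ ((n : ℝ≥0) : ℝ≥0∞) := by
  rw [ENNReal.coe_natCast]
  exact min_le_right _ _

theorem measurable_truncPot (hq : Measurable q) (n : ℕ) : Measurable (truncPot q n) :=
  hq.min measurable_const

theorem truncPot_mono (q : Space d → ℝ≥0∞) {m n : ℕ} (h : m ≤ n) (z : Space d) :
    truncPot q m z ≤ truncPot q n z :=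
  min_le_min_left _ (Nat.cast_le.2 h)

theorem eventually_truncPot_eq {z : Space d} (hz : q z ≠ ⊤) :
    ∀ᶠ n : ℕ in atTop, truncPot q n z = q z := by
  obtain ⟨N, hN⟩ := ENNReal.exists_nat_gt hz
  filter_upwards [eventually_ge_atTop N] with n hn
  exact min_eq_left (hN.le.trans (Nat.cast_le.2 hn))

theorem iSup_truncPot (z : Space d) : ⨆ n, truncPot q n z = q z := by
  unfold truncPot
  rw [← inf_iSup_eq, ENNReal.iSup_natCast, inf_top_eq]

theorem measKer_truncHeat (hq : Measurable q) (n : ℕ) : MeasKer (truncHeat q n) :=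
  measKer_killedHeat (measurable_truncPot hq n)

theorem measKer_limitHeat (hq : Measurable q) : MeasKer (limitHeat q) :=
  Measurable.iInf fun n => measKer_truncHeat hq n

theorem truncHeat_le (q : Space d → ℝ≥0∞) (n : ℕ) (t : ℝ) (x y : Space d) :
    truncHeat q n t x y ≤ heat d t x y := killedHeat_le _ _ t x y

theorem limitHeat_le (q : Space d → ℝ≥0∞) (t : ℝ) (x y : Space d) :
    limitHeat q t x y ≤ heat d t x y := (iInf_le _ 0).trans (truncHeat_le q 0 t x y)

theorem limitHeat_ne_top (q : Space d → ℝ≥0∞) (t : ℝ) (x y : Space d) :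
    limitHeat q t x y ≠ ⊤ := ne_top_of_le_ne_top (heat_ne_top t x y) (limitHeat_le q t x y)

theorem truncHeat_duhamel (hq : Measurable q) (n : ℕ) :
    truncHeat q n + conv (truncHeat q n) (truncPot q n) (heat d) = heat d :=
  killedHeat_duhamel_left (measurable_truncPot hq n) (truncPot_le q n)

/-- The resolvent identity against a truncation: every Duhamel solution for a larger potential lies
below `truncHeat q n`, with an explicit gap. -/
theorem truncHeat_eq_add {H : TimeKernel d} {p : Space d → ℝ≥0∞} (hq : Measurable q)
    (hp : Measurable p) (hH : MeasKer H) (eH : H + conv H p (heat d) = heat d) (n : ℕ)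
    (hle : ∀ z, truncPot q n z ≤ p z) :
    truncHeat q n = H + conv H (p - truncPot q n) (truncHeat q n) := by
  refine resolvent_identity (q := truncPot q n) hH (measKer_truncHeat hq n)
    (measurable_truncPot hq n) (hp.sub (measurable_truncPot hq n)) ?_
    (killedHeat_duhamel_right (measurable_truncPot hq n) (truncPot_le q n))
  have : truncPot q n + (p - truncPot q n) = p := by
    funext z
    exact add_tsub_cancel_of_le (hle z)
  rwa [this]

theorem antitone_truncHeat (hq : Measurable q) (t : ℝ) (x y : Space d) :
    Antitone fun n => truncHeat q n t x y := by
  intro m n hmn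
  have h := truncHeat_eq_add hq (measurable_truncPot hq n) (measKer_truncHeat hq n)
    (truncHeat_duhamel hq n) m (truncPot_mono q hmn)
  have h' := congrFun (congrFun (congrFun h t) x) y
  dsimp only
  rw [h']
  exact le_self_add

theorem tendsto_truncHeat (hq : Measurable q) (t : ℝ) (x y : Space d) :
    Tendsto (fun n => truncHeat q n t x y) atTop (𝓝 (limitHeat q t x y)) :=
  tendsto_atTop_iInf (antitone_truncHeat hq t x y)

/-- Dominated convergence on space-time with majorant `A q g`. Pointwise convergence is asked only
where `A q` is finite, which disposes of the points with `q = ⊤`. -/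
theorem tendsto_conv_heat {A A' : TimeKernel d} {r' : Space d → ℝ≥0∞} {An : ℕ → TimeKernel d}
    {rn : ℕ → Space d → ℝ≥0∞} (hA : MeasKer A) (hq : Measurable q) (hA' : MeasKer A')
    (hr' : Measurable r') (hAn : ∀ n, MeasKer (An n)) (hrn : ∀ n, Measurable (rn n))
    {t : ℝ} {x y : Space d} (hfin : conv A q (heat d) t x y ≠ ⊤)
    (hle : ∀ n, ∀ s ∈ Ioo 0 t, ∀ z, An n s x z * rn n z ≤ A s x z * q z)
    (hlim : ∀ s ∈ Ioo 0 t, ∀ z, A s x z * q z ≠ ⊤ →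
      Tendsto (fun n => An n s x z * rn n z) atTop (𝓝 (A' s x z * r' z))) :
    Tendsto (fun n => conv (An n) (rn n) (heat d) t x y) atTop
      (𝓝 (conv A' r' (heat d) t x y)) := by
  have hg := measKer_heat (d := d)
  have hprod : ∀ {B : TimeKernel d} {r : Space d → ℝ≥0∞}, MeasKer B → Measurable r →
      (Measurable fun p : ℝ × Space d => B p.1 x p.2 * r p.2 * heat d (t - p.1) p.2 y) ∧
      conv B r (heat d) t x y = ∫⁻ p, B p.1 x p.2 * r p.2 * heat d (t - p.1) p.2 y
        ∂((volume.restrict (Ioo 0 t)).prod volume) := by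
    intro B r hB hr
    unfold MeasKer at hB hg
    have hm : Measurable fun p : ℝ × Space d => B p.1 x p.2 * r p.2 * heat d (t - p.1) p.2 y := by
      fun_prop
    exact ⟨hm, (lintegral_prod _ hm.aemeasurable).symm⟩
  have hIoo : ∀ᵐ p : ℝ × Space d ∂((volume.restrict (Ioo 0 t)).prod volume), p.1 ∈ Ioo 0 t :=
    Measure.quasiMeasurePreserving_fst.ae (ae_restrict_mem measurableSet_Ioo)
  rw [(hprod hA' hr').2]
  simp_rw [fun n => (hprod (hAn n) (hrn n)).2]
  rw [(hprod hA hq).2] at hfin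
  refine tendsto_lintegral_of_dominated_convergence _ (fun n => (hprod (hAn n) (hrn n)).1)
    (fun n => ?_) hfin ?_
  · filter_upwards [hIoo] with p hp
    exact mul_le_mul_left (hle n p.1 hp p.2) _
  -- The majorant is finite almost everywhere and `g > 0`, so `A q` is finite there.
  · filter_upwards [hIoo, ae_lt_top (hprod hA hq).1 hfin] with p hp hp'
    refine ENNReal.Tendsto.mul_const (hlim p.1 hp p.2 fun htop => ?_)
      (Or.inr (heat_ne_top _ _ _))
    rw [htop, ENNReal.top_mul (heat_ne_zero (sub_pos.2 hp.2) _ _)] at hp'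
    exact lt_irrefl _ hp'

/-- A solution of the Duhamel formula equals the decreasing limit. -/
theorem eq_limitHeat_of_duhamel (hq : Measurable q) {H : TimeKernel d} (hH : MeasKer H)
    (eH : H + conv H q (heat d) = heat d) : H = limitHeat q := by
  have hle : ∀ n z, truncPot q n z ≤ q z := fun n z => min_le_left _ _
  have hr : ∀ n, Measurable (q - truncPot q n) := fun n => hq.sub (measurable_truncPot hq n)
  have h := fun n => truncHeat_eq_add hq hq hH eH n (hle n)
  funext t x y
  have h' := fun n => congrFun (congrFun (congrFun (h n) t) x) y
  refine le_antisymm (le_iInf fun n => ?_) ?_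
  · rw [h']
    exact le_self_add
  have hfin : conv H q (heat d) t x y ≠ ⊤ :=
    ne_top_of_le_ne_top (heat_ne_top t x y) (le_of_add_eq eH t x y)
  -- The gap is at most `H (q - min q n) g`, which tends to `0`: where `H q` is finite, either `H =
  -- 0` or `q` is finite and its truncation error eventually vanishes.
  have hlim := tendsto_conv_heat (An := fun _ => H) (rn := fun n => q - truncPot q n) (A' := H)
    (r' := 0) hH hq hH measurable_const (fun _ => hH) hr hfin
    (fun n s _ z => mul_le_mul_right tsub_le_self _) (fun s _ z hz => ?_)
  · have h0 : conv H 0 (heat d) t x y = 0 := by simp [conv]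
    rw [h0] at hlim
    have hlim' := hlim.const_add (H t x y)
    rw [add_zero] at hlim'
    refine ge_of_tendsto' hlim' fun n => (iInf_le _ n).trans ?_
    rw [h']
    exact add_le_add_right (conv_mono (fun _ _ _ => le_rfl) (fun _ => le_rfl)
      fun s _ z => truncHeat_le q n s z y) _
  · rcases eq_or_ne (H s x z) 0 with h0 | h0
    · simp [h0]
    · have hqz : q z ≠ ⊤ := fun htop => hz (by rw [htop, ENNReal.mul_top h0])
      refine tendsto_const_nhds.congr' ?_
      filter_upwards [eventually_truncPot_eq hqz] with n hn
      simp [hn]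

/-- The decreasing limit solves the Duhamel formula if the bridge potential is finite. -/
theorem limitHeat_duhamel (hq : Measurable q) (hfin : ∀ t x y, conv (heat d) q (heat d) t x y ≠ ⊤) :
    limitHeat q + conv (limitHeat q) q (heat d) = heat d := by
  funext t x y
  have h := fun n => congrFun (congrFun (congrFun (truncHeat_duhamel hq n) t) x) y
  have hlim := tendsto_conv_heat (An := fun n => truncHeat q n) (rn := fun n => truncPot q n)
    (A' := limitHeat q) (r' := q) measKer_heat hq (measKer_limitHeat hq) hq
    (measKer_truncHeat hq) (measurable_truncPot hq) (hfin t x y)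
    (fun n s _ z => mul_le_mul' (truncHeat_le q n s x z) (min_le_left _ _)) (fun s hs z hz => ?_)
  · refine tendsto_nhds_unique ((tendsto_truncHeat hq t x y).add hlim) ?_
    refine tendsto_const_nhds.congr fun n => ?_
    exact (h n).symm
  · have hqz : q z ≠ ⊤ := fun htop => hz (by rw [htop, ENNReal.mul_top (heat_ne_zero hs.1 _ _)])
    refine ENNReal.Tendsto.mul (tendsto_truncHeat hq s x z) (Or.inr hqz) ?_
      (Or.inr (limitHeat_ne_top q s x z))
    refine tendsto_const_nhds.congr' ?_
    filter_upwards [eventually_truncPot_eq hqz] with n hn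
    exact hn.symm

/-- The lower bound `g exp(-S)` for the perturbation by an unbounded potential. -/
theorem exp_neg_mul_heat_le_limitHeat (hq : Measurable q) {t a : ℝ} (ht : 0 < t)
    (ha : 0 ≤ a) {x y : Space d}
    (h : conv (heat d) q (heat d) t x y ≤ ENNReal.ofReal a * heat d t x y) :
    ENNReal.ofReal (Real.exp (-a)) * heat d t x y ≤ limitHeat q t x y := by
  refine le_iInf fun n => ?_
  refine le_trans ?_ (jensenLower_le_killedHeat (measurable_truncPot hq n) (truncPot_le q n) ht x y)
  rw [jensenLower, mul_comm]
  refine mul_le_mul_right (ENNReal.ofReal_le_ofReal (Real.exp_le_exp.2 (neg_le_neg ?_))) _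
  refine ENNReal.toReal_le_of_le_ofReal ha (ENNReal.div_le_of_le_mul (le_trans ?_ h))
  exact conv_mono (fun _ _ _ => le_rfl) (fun _ => min_le_left _ _) fun _ _ _ => le_rfl

theorem conv_const_mul_left {A B : TimeKernel d} (hA : MeasKer A) (hq : Measurable q)
    (hB : MeasKer B) (c : ℝ≥0∞) (t : ℝ) (x y : Space d) :
    conv (fun t x y => c * A t x y) q B t x y = c * conv A q B t x y := by
  unfold MeasKer at hA hB
  unfold conv
  rw [← lintegral_const_mul _ (by fun_prop)]
  refine lintegral_congr fun s => ?_
  rw [← lintegral_const_mul _ (by fun_prop)]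
  exact lintegral_congr fun z => by ring

theorem conv_heat_eq_iSup (hq : Measurable q) (t : ℝ) (x y : Space d) :
    conv (heat d) q (heat d) t x y = ⨆ n, conv (heat d) (truncPot q n) (heat d) t x y := by
  have hg := measKer_heat (d := d)
  unfold MeasKer at hg
  have hm := measurable_truncPot hq
  unfold conv
  rw [← lintegral_iSup (fun n => by have := hm n; fun_prop)]
  · refine lintegral_congr fun s => ?_
    rw [← lintegral_iSup (fun n => by have := hm n; fun_prop)]
    · simp_rw [← ENNReal.iSup_mul, ← ENNReal.mul_iSup, iSup_truncPot]
    · intro m n hmn z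
      exact mul_le_mul_left (mul_le_mul_right (truncPot_mono q hmn z) _) _
  · intro m n hmn s
    exact lintegral_mono fun z => mul_le_mul_left (mul_le_mul_right (truncPot_mono q hmn z) _) _

/-- A lower bound of the perturbed kernel by `c g` bounds the bridge potential by `1/c`. -/
theorem mul_conv_heat_le (hq : Measurable q) {c : ℝ≥0∞} {t : ℝ}
    (h : ∀ s ∈ Ioo 0 t, ∀ x y, c * heat d s x y ≤ limitHeat q s x y) (x y : Space d) :
    c * conv (heat d) q (heat d) t x y ≤ heat d t x y := by
  -- Working with truncations avoids Duhamel's formula for the limit, which is not yet available: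
  -- `limitHeat` lies below each `truncHeat`, whose formula is known.
  rw [conv_heat_eq_iSup hq, ENNReal.mul_iSup]
  refine iSup_le fun n => ?_
  rw [← conv_const_mul_left measKer_heat (measurable_truncPot hq n) measKer_heat]
  refine le_trans (conv_mono (fun s hs z => (h s hs x z).trans (iInf_le _ n)) (fun _ => le_rfl)
    fun _ _ _ => le_rfl) (le_of_add_eq (truncHeat_duhamel hq n) t x y)

end

/-! ### The bridge potential and the Schrödinger kernel -/

section

variable {V : Space d → EReal}

/-- The absolute value of the potential. -/
noncomputable def absPot (V : Space d → EReal) : Space d → ℝ≥0∞ := fun z => (V z).abs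

theorem abs_eq_toENNReal_neg {v : EReal} (hv : v ≤ 0) : v.abs = (-v).toENNReal := by
  induction v with
  | bot => simp
  | top => simp at hv
  | coe v =>
    have hv' : v ≤ 0 := by exact_mod_cast hv
    rw [EReal.abs_def, abs_of_nonpos hv', ← EReal.coe_neg, EReal.toENNReal_of_ne_top (by simp)]
    simp

theorem measurable_absPot (hVm : Measurable V) (hV : ∀ z, V z ≤ 0) : Measurable (absPot V) := by
  have : absPot V = fun z => (-V z).toENNReal := funext fun z => abs_eq_toENNReal_neg (hV z)
  rw [this]
  exact hVm.neg.ereal_toENNReal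

theorem toReal_heat {t : ℝ} (ht : 0 < t) (x y : Space d) :
    (heat d t x y).toReal = gauss t x y := by
  rw [heat_of_pos ht, ENNReal.toReal_ofReal (gauss_pos ht x y).le]

theorem truncatedKernel_eq (hq : Measurable (absPot V)) (n : ℕ) {t : ℝ} (ht : 0 < t)
    (x y : Space d) : truncatedKernel V n t x y = (truncHeat (absPot V) n t x y).toReal :=
  (hasSum_seriesTerm (measurable_truncPot hq n) (truncPot_le _ n) (measKer_truncHeat hq n)
    (truncHeat_duhamel hq n) ht x y).tsum_eq

theorem schroedingerKernel_eq (hq : Measurable (absPot V)) {t : ℝ} (ht : 0 < t) (x y : Space d) :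
    schroedingerKernel V t x y = (limitHeat (absPot V) t x y).toReal := by
  unfold schroedingerKernel limitHeat
  simp_rw [truncatedKernel_eq hq _ ht]
  rw [ENNReal.toReal_iInf fun n =>
    ne_top_of_le_ne_top (heat_ne_top t x y) (truncHeat_le (absPot V) n t x y)]

theorem ofReal_schroedingerKernel (hq : Measurable (absPot V)) {t : ℝ} (ht : 0 < t)
    (x y : Space d) :
    ENNReal.ofReal (schroedingerKernel V t x y) = limitHeat (absPot V) t x y := by
  rw [schroedingerKernel_eq hq ht, ENNReal.ofReal_toReal (limitHeat_ne_top _ t x y)]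

theorem schroedingerKernel_le (hq : Measurable (absPot V)) {t : ℝ} (ht : 0 < t) (x y : Space d) :
    schroedingerKernel V t x y ≤ gauss t x y := by
  rw [schroedingerKernel_eq hq ht, ← toReal_heat ht]
  exact ENNReal.toReal_mono (heat_ne_top t x y) (limitHeat_le _ t x y)

theorem bridgePotential_eq (hq : Measurable (absPot V)) {t : ℝ} (ht : 0 < t) (x y : Space d) :
    bridgePotential V t x y = conv (heat d) (absPot V) (heat d) t x y / heat d t x y := by
  have hg := measKer_heat (d := d)
  unfold MeasKer at hg
  unfold conv bridgePotential
  rw [div_eq_mul_inv, ← lintegral_mul_const _ (by fun_prop)]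
  refine setLIntegral_congr_fun measurableSet_Ioo fun s hs => ?_
  rw [← lintegral_mul_const _ (by fun_prop)]
  refine lintegral_congr fun z => ?_
  rw [ENNReal.ofReal_div_of_pos (gauss_pos ht x y), ENNReal.ofReal_mul (gauss_pos hs.1 x z).le,
    heat_of_pos ht, heat_of_pos hs.1, heat_of_pos (sub_pos.2 hs.2), div_eq_mul_inv, absPot]
  ring

theorem bridgePotential_le_iff (hq : Measurable (absPot V)) {t : ℝ} (ht : 0 < t) (x y : Space d)
    {c : ℝ≥0∞} : bridgePotential V t x y ≤ c ↔
      conv (heat d) (absPot V) (heat d) t x y ≤ c * heat d t x y := by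
  rw [bridgePotential_eq hq ht, ENNReal.div_le_iff (heat_ne_zero ht x y) (heat_ne_top t x y)]

theorem supBridge_le_iff (hq : Measurable (absPot V)) {t : ℝ} (ht : 0 < t) {c : ℝ≥0∞} :
    supBridge V t ≤ c ↔
      ∀ x y, conv (heat d) (absPot V) (heat d) t x y ≤ c * heat d t x y := by
  simp only [supBridge, iSup_le_iff, bridgePotential_le_iff hq ht]

theorem conv_heat_le_supBridge (hq : Measurable (absPot V)) {t : ℝ} (ht : 0 < t) (x y : Space d) :
    conv (heat d) (absPot V) (heat d) t x y ≤ supBridge V t * heat d t x y :=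
  (supBridge_le_iff hq ht).1 le_rfl x y

/-- Splitting at time `s`, each piece is bounded by its supremum and the remaining product of
Gaussians integrates to `g(s+t,x,y)`. -/
theorem supBridge_add_le (hq : Measurable (absPot V)) {s t : ℝ} (hs : 0 < s) (ht : 0 < t) :
    supBridge V (s + t) ≤ supBridge V s + supBridge V t := by
  have hg := measKer_heat (d := d)
  unfold MeasKer at hg
  refine (supBridge_le_iff hq (add_pos hs ht)).2 fun x y => ?_
  rw [conv_heat_split hq hs ht, add_mul]
  refine add_le_add ?_ ?_
  · rw [← isSemigroup_heat s t hs ht, ← lintegral_const_mul _ (by fun_prop)]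
    refine lintegral_mono fun z => ?_
    rw [← mul_assoc]
    exact mul_le_mul_left (conv_heat_le_supBridge hq hs x z) _
  · rw [← isSemigroup_heat s t hs ht, ← lintegral_const_mul _ (by fun_prop)]
    refine lintegral_mono fun z => ?_
    rw [mul_left_comm]
    exact mul_le_mul_right (conv_heat_le_supBridge hq ht z y) _

theorem supBridge_nat_mul_add_le (hq : Measurable (absPot V)) {T r : ℝ} (hT : 0 < T) (hr : 0 < r)
    (k : ℕ) : supBridge V (k * T + r) ≤ k * supBridge V T + supBridge V r := by
  induction k with
  | zero => simp
  | succ k ih =>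
    have e : ((k + 1 : ℕ) : ℝ) * T + r = T + (k * T + r) := by
      push_cast
      ring
    rw [e]
    refine (supBridge_add_le hq hT (by positivity)).trans ((add_le_add_right ih _).trans_eq ?_)
    push_cast
    ring

theorem supBridge_le_supBridgeUpTo {T r : ℝ} (hr : r ∈ Ioc 0 T) :
    supBridge V r ≤ supBridgeUpTo V T :=
  le_iSup₂ (f := fun (t : ℝ) (_ : t ∈ Ioc 0 T) => supBridge V t) r hr

/-- Linear growth in time of the supremum of the bridge potential. -/
theorem supBridge_le_linear (hq : Measurable (absPot V)) {T t : ℝ} (hT : 0 < T) (ht : 0 < t) :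
    supBridge V t ≤ ENNReal.ofReal (t / T) * supBridge V T + supBridgeUpTo V T := by
  -- The ceiling minus one, not the floor, keeps the remainder `t - k * T` in `(0, T]`, hence
  -- positive even at multiples of `T`.
  obtain ⟨k, hk⟩ : ∃ k : ℕ, ⌈t / T⌉₊ = k + 1 :=
    Nat.exists_eq_succ_of_ne_zero (Nat.ceil_pos.2 (div_pos ht hT)).ne'
  have h1 : (k : ℝ) < t / T := Nat.lt_ceil.1 (by omega)
  have h2 : t / T ≤ k + 1 := by
    have := Nat.le_ceil (t / T)
    rw [hk] at this
    exact_mod_cast this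
  rw [lt_div_iff₀ hT] at h1
  rw [div_le_iff₀ hT] at h2
  have h := supBridge_nat_mul_add_le (V := V) hq hT (sub_pos.2 h1) k
  rw [add_sub_cancel] at h
  refine h.trans (add_le_add (mul_le_mul_left ?_ _) (supBridge_le_supBridgeUpTo ⟨sub_pos.2 h1, ?_⟩))
  · rw [← ENNReal.ofReal_natCast]
    exact ENNReal.ofReal_le_ofReal ((le_div_iff₀ hT).2 h1.le)
  · linarith

theorem supBridgeUpTo_lt_top (hq : Measurable (absPot V)) {T : ℝ}
    (h : LocalSharpBounds (schroedingerKernel V) T) : supBridgeUpTo V T < ⊤ := by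
  obtain ⟨c₁, c₂, hc₁, -, hb⟩ := h
  have hc : ENNReal.ofReal c₁ ≠ 0 := (ENNReal.ofReal_pos.2 hc₁).ne'
  have hlow : ∀ s : ℝ, 0 < s → s ≤ T → ∀ x y : Space d,
      ENNReal.ofReal c₁ * heat d s x y ≤ limitHeat (absPot V) s x y := by
    intro s hs hsT x y
    rw [← ofReal_schroedingerKernel hq hs, heat_of_pos hs, ← ENNReal.ofReal_mul hc₁.le]
    exact ENNReal.ofReal_le_ofReal ((le_div_iff₀ (gauss_pos hs x y)).1 (hb s hs hsT x y).1)
  refine lt_of_le_of_lt (iSup₂_le fun t ht => ?_) (ENNReal.inv_lt_top.2 hc.bot_lt)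
  refine (supBridge_le_iff hq ht.1).2 fun x y => ?_
  rw [mul_comm, ← div_eq_mul_inv,
    ENNReal.le_div_iff_mul_le (Or.inl hc) (Or.inl ENNReal.ofReal_ne_top), mul_comm]
  exact mul_conv_heat_le hq (fun s hs => hlow s hs.1 (hs.2.le.trans ht.2)) x y

theorem expLowerBound_of_supBridgeUpTo_lt_top (hq : Measurable (absPot V)) {T : ℝ} (hT : 0 < T)
    (h : supBridgeUpTo V T < ⊤) :
    ExpLowerBound (schroedingerKernel V) (Real.exp (-(supBridgeUpTo V T).toReal))
      ((supBridge V T).toReal / T) := by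
  intro t ht x y
  have hT' : supBridge V T ≠ ⊤ :=
    ne_top_of_le_ne_top h.ne (supBridge_le_supBridgeUpTo ⟨hT, le_rfl⟩)
  -- This bounds `S(V,t,·,·)` by linear growth, and `exp (-a)` is exactly `C e^{-ct}` for the stated
  -- constants.
  set a : ℝ := t / T * (supBridge V T).toReal + (supBridgeUpTo V T).toReal with ha
  have ha0 : 0 ≤ a := by positivity
  have hbound : conv (heat d) (absPot V) (heat d) t x y ≤ ENNReal.ofReal a * heat d t x y := by
    refine (conv_heat_le_supBridge hq ht x y).trans (mul_le_mul_left ?_ _)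
    rw [ha, ENNReal.ofReal_add (by positivity) (by positivity), ENNReal.ofReal_mul (by positivity),
      ENNReal.ofReal_toReal hT', ENNReal.ofReal_toReal h.ne]
    exact supBridge_le_linear hq hT ht
  have h1 := ENNReal.toReal_mono (limitHeat_ne_top _ t x y)
    (exp_neg_mul_heat_le_limitHeat hq ht ha0 hbound)
  rw [ENNReal.toReal_mul, ENNReal.toReal_ofReal (Real.exp_pos _).le, toReal_heat ht,
    ← schroedingerKernel_eq hq ht] at h1
  refine le_trans (le_of_eq ?_) h1
  rw [← Real.exp_add]
  congr 2
  rw [ha]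
  ring

theorem isDuhamelSolution_schroedingerKernel (hq : Measurable (absPot V)) {T : ℝ} (hT : 0 < T)
    (h : supBridgeUpTo V T < ⊤) : IsDuhamelSolution V (schroedingerKernel V) := by
  have hT' : supBridge V T ≠ ⊤ :=
    ne_top_of_le_ne_top h.ne (supBridge_le_supBridgeUpTo ⟨hT, le_rfl⟩)
  have hfin : ∀ t x y, conv (heat d) (absPot V) (heat d) t x y ≠ ⊤ := by
    intro t x y
    rcases le_or_gt t 0 with ht | ht
    · rw [conv_of_nonpos ht]
      exact ENNReal.zero_ne_top
    · refine ne_top_of_le_ne_top (ENNReal.mul_ne_top ?_ (heat_ne_top t x y))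
        (conv_heat_le_supBridge hq ht x y)
      exact ne_top_of_le_ne_top (ENNReal.add_ne_top.2
        ⟨ENNReal.mul_ne_top ENNReal.ofReal_ne_top hT', h.ne⟩) (supBridge_le_linear hq hT ht)
  have e := limitHeat_duhamel hq hfin
  refine ⟨?_, fun t ht x y => ?_, fun t ht x y => ?_⟩
  · have hm := measKer_limitHeat hq
    unfold MeasKer at hm
    have : (fun p : Ioi (0 : ℝ) × Space d × Space d => schroedingerKernel V p.1 p.2.1 p.2.2) =
        fun p => (limitHeat (absPot V) p.1 p.2.1 p.2.2).toReal :=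
      funext fun p => schroedingerKernel_eq hq p.1.2 _ _
    rw [this]
    fun_prop
  · rw [schroedingerKernel_eq hq ht]
    exact ENNReal.toReal_nonneg
  · rw [← heat_of_pos ht, ← congrFun (congrFun (congrFun e t) x) y,
      ofReal_schroedingerKernel hq ht]
    refine congrArg (limitHeat (absPot V) t x y + ·) ?_
    refine setLIntegral_congr_fun measurableSet_Ioo fun s hs => lintegral_congr fun z => ?_
    rw [ofReal_schroedingerKernel hq hs.1, heat_of_pos (sub_pos.2 hs.2)]
    rfl

theorem IsDuhamelSolution.eq_schroedingerKernel (hq : Measurable (absPot V))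
    {H : ℝ → Space d → Space d → ℝ} (hH : IsDuhamelSolution V H) {t : ℝ} (ht : 0 < t)
    (x y : Space d) : H t x y = schroedingerKernel V t x y := by
  set A : TimeKernel d := fun t x y => if 0 < t then ENNReal.ofReal (H t x y) else 0 with hA
  have hApos : ∀ {t : ℝ}, 0 < t → ∀ x y, A t x y = ENNReal.ofReal (H t x y) :=
    fun h x y => if_pos h
  have hm : MeasKer A := by
    unfold MeasKer
    have hS : MeasurableSet {p : ℝ × Space d × Space d | 0 < p.1} :=
      measurableSet_lt measurable_const measurable_fst
    -- Measurability of `H` is known only for positive times, so it is glued with the zero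
    -- extension.
    refine measurable_of_restrict_of_restrict_compl hS ?_ ?_
    · have h1 : Measurable fun p : {p : ℝ × Space d × Space d | 0 < p.1} =>
          ((⟨p.1.1, p.2⟩, p.1.2) : Ioi (0 : ℝ) × Space d × Space d) := by
        refine Measurable.prodMk (Measurable.subtype_mk ?_) ?_ <;> fun_prop
      have h2 := (hH.measurable.comp h1).ennreal_ofReal
      convert h2 using 1
      funext p
      exact hApos p.2 _ _
    · convert (measurable_const : Measurable fun _ => (0 : ℝ≥0∞)) using 1
      funext p
      exact if_neg p.2
  have e : A + conv A (absPot V) (heat d) = heat d := by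
    funext t x y
    rcases le_or_gt t 0 with ht | ht
    · simp [hA, conv_of_nonpos ht, heat_of_nonpos ht, not_lt.2 ht]
    · rw [heat_of_pos ht, ← hH.duhamel t ht x y, ← hApos ht]
      refine congrArg (A t x y + ·) ?_
      refine setLIntegral_congr_fun measurableSet_Ioo fun s hs => lintegral_congr fun z => ?_
      rw [hApos hs.1, heat_of_pos (sub_pos.2 hs.2)]
      rfl
  rw [schroedingerKernel_eq hq ht, ← eq_limitHeat_of_duhamel hq hm e, hApos ht,
    ENNReal.toReal_ofReal (hH.nonneg t ht x y)]

theorem localSharpBounds_of_expLowerBound (hq : Measurable (absPot V)) {T C c : ℝ} (hT : 0 < T)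
    (hC : 0 < C) (hc : 0 ≤ c) (h : ExpLowerBound (schroedingerKernel V) C c) :
    LocalSharpBounds (schroedingerKernel V) T := by
  have hlow : ∀ t : ℝ, 0 < t → t ≤ T → ∀ x y : Space d,
      C * Real.exp (-c * T) ≤ schroedingerKernel V t x y / gauss t x y := by
    intro t ht htT x y
    rw [le_div_iff₀ (gauss_pos ht x y)]
    refine le_trans ?_ (h t ht x y)
    refine mul_le_mul_of_nonneg_right (mul_le_mul_of_nonneg_left (Real.exp_le_exp.2 ?_) hC.le)
      (gauss_pos ht x y).le
    nlinarith
  have hup : ∀ t : ℝ, 0 < t → ∀ x y : Space d,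
      schroedingerKernel V t x y / gauss t x y ≤ 1 := fun t ht x y =>
    div_le_one_of_le₀ (schroedingerKernel_le hq ht x y) (gauss_pos ht x y).le
  -- That `c₁ ≤ c₂` is read off by comparing both bounds at `t = T`, `x = y = 0`.
  exact ⟨C * Real.exp (-c * T), 1, by positivity, (hlow T hT le_rfl 0 0).trans (hup T hT 0 0),
    fun t ht htT x y => ⟨hlow t ht htT x y, hup t ht x y⟩⟩

end

end Schroedinger

theorem mainTheorem7 (d : ℕ) (hd : 1 ≤ d) (V : Schroedinger.Space d → EReal)
    (hVmeas : Measurable V) (hV : ∀ z, V z ≤ 0) (T : ℝ) (hT : 0 < T) :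
    -- equivalence of the local sharp bounds and the exponential lower bound
    (Schroedinger.LocalSharpBounds (Schroedinger.schroedingerKernel V) T ↔
      ∃ C c : ℝ, 0 < C ∧ 0 ≤ c ∧
        Schroedinger.ExpLowerBound (Schroedinger.schroedingerKernel V) C c) ∧
    -- the explicit constants
    (Schroedinger.LocalSharpBounds (Schroedinger.schroedingerKernel V) T →
      Schroedinger.supBridgeUpTo V T < ⊤ ∧ Schroedinger.supBridge V T < ⊤ ∧
      Schroedinger.ExpLowerBound (Schroedinger.schroedingerKernel V)
        (Real.exp (-(Schroedinger.supBridgeUpTo V T).toReal))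
        ((Schroedinger.supBridge V T).toReal / T)) ∧
    -- `G` is determined by the Duhamel formula: it is the only possible solution,
    -- and it is a solution if the local sharp bounds hold
    (∀ H : ℝ → Schroedinger.Space d → Schroedinger.Space d → ℝ,
      Schroedinger.IsDuhamelSolution V H →
        ∀ t : ℝ, 0 < t → ∀ x y, H t x y = Schroedinger.schroedingerKernel V t x y) ∧
    (Schroedinger.LocalSharpBounds (Schroedinger.schroedingerKernel V) T →
      Schroedinger.IsDuhamelSolution V (Schroedinger.schroedingerKernel V)) := by
  have hq := Schroedinger.measurable_absPot hVmeas hV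
  refine ⟨⟨fun h => ?_, fun ⟨C, c, hC, hc, h⟩ =>
    Schroedinger.localSharpBounds_of_expLowerBound hq hT hC hc h⟩, fun h => ?_,
    fun H hH t ht x y => hH.eq_schroedingerKernel hq ht x y, fun h =>
    Schroedinger.isDuhamelSolution_schroedingerKernel hq hT
      (Schroedinger.supBridgeUpTo_lt_top hq h)⟩
  · exact ⟨_, _, Real.exp_pos _, by positivity,
      Schroedinger.expLowerBound_of_supBridgeUpTo_lt_top hq hT
        (Schroedinger.supBridgeUpTo_lt_top hq h)⟩
  · have hf := Schroedinger.supBridgeUpTo_lt_top hq h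
    exact ⟨hf, (Schroedinger.supBridge_le_supBridgeUpTo ⟨hT, le_rfl⟩).trans_lt hf,
      Schroedinger.expLowerBound_of_supBridgeUpTo_lt_top hq hT hf⟩
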